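/- Setting. Hybrid active object (HABS) programs consist of classes and a main block. A class $C$ has discrete and physical fields (with an ODE $\mathsf{ode}_C$), an initial block, methods with pre- and postconditions, a creation condition and an object invariant $I_C$. Class names, and the method names within a class, are unique, only declared methods are called, and each specification refers only to the variables in its scope. The blocks of $C$ are its constructor and its methods. A method is a controller of $C$ if it starts with an await statement, contains no other await and no get or duration statement, ends with a recursive call on this, and, apart from that recursive call, is called (on this) from the initial block of $C$ and from no block other than the initial block of $C$. For a formula $\psi$ let $\mathsf{pr}(\psi)=I_C\wedge[t:=0;\{\mathsf{ode}_C,t'=1\ \&\ \psi\}]I_C$. Let $\Psi$ be the post-region generator that maps every constructor, method and await statement of $C$ to $\bigwedge_{k}\widetilde{\neg}\,\mathit{ttrig}_k$, where $k$ ranges over the controllers of $C$, $\mathit{ttrig}_k$ is the condition under which the leading guard of $k$ holds (the translated expression for a differential guard, $t\ge e$ for a duration guard with parameter $e$, and false for a future guard), and $\widetilde{\neg}$ is negation that turns weak inequalities into the reversed weak inequalities. The proof obligation of a method $m$ of $C$ is the differential dynamic logic formula $$I_C\wedge\mathsf{pre}_m\wedge \mathit{cll}\doteq 0\ \rightarrow\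 [\mathsf{trans}(s_m)]\bigl(\mathit{cll}\doteq 0\wedge\mathsf{post}_m\wedge\mathsf{pr}(\Psi(m))\bigr),$$ where $\mathsf{trans}$ translates the method body $s_m$ (including its return statement) into a hybrid program that checks called preconditions and creation conditions, and safety at await (with the region $\Psi$), get and duration statements, recording a failure in $\mathit{cll}$. The obligation of the constructor is analogous, with the creation condition as its only specification. $C$ is verified (with structurally controlled regions) if the obligations of its constructor and of all its methods are valid. After a change of the program, a block has to be reproven if its new proof obligation is not the same formula as its old one. Lemma. Let $C$ be a verified class of such a program. For a method $m^-$ of $C$ let $C^-$ be $C$ after $m^-$ has been removed and all calls to it, in the whole program, have been replaced by skip. Let $C^+$ be $C$ with one method added, such that the extended program satisfies the same conventions. 1. If $m^-$ is a controller, and its removal turns no other method of $C$ into a controller, then all methods of $C^-$, and its constructor, have to be reproven. This cannot be avoided: for every $n\in\mathbb N$ there are a program in which every method starts with an await statement with a differential guard, a verified class $C$ of it, and a controller $m^-$ of $C$ whose removal turns no other method into a controller, such that $C^-$ has exactly $n$ methods and the proof obligations of all of them and of the constructor of $C^-$ are not valid. 2. If $m^-$ is not a controller, then $C^-$ is verified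 if and only if the proof obligations of those blocks of $C^-$ are valid that call $m^-$ in $C$. If, moreover, the removal turns no method of $C$ into a controller, then the blocks of $C^-$ that have to be reproven are exactly those that call $m^-$ in $C$. 3. If the added method calls no controller of $C$, then $C^+$ is verified if and only if the proof obligation of the added method is valid, and no block of $C$ has to be reproven. -/

import Mathlib

noncomputable section

namespace HABS

/-! ## Terms and differential dynamic logic -/

/-- Names of classes, methods, fields and local variables. -/
abbrev Name := ℕ

/-- Binary operators shared by program expressions and terms. -/
inductive BinOp
  | add | sub | mul | div | le | ge | and | or

open scoped Classical in
/-- The value of a binary operator. The truth values are represented by `1` (true) and `0` (false). -/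
def BinOp.eval : BinOp → ℝ → ℝ → ℝ
  | .add, a, b => a + b
  | .sub, a, b => a - b
  | .mul, a, b => a * b
  | .div, a, b => a / b
  | .le, a, b => if a ≤ b then 1 else 0
  | .ge, a, b => if a ≥ b then 1 else 0
  | .and, a, b => if a = 1 ∧ b = 1 then 1 else 0
  | .or, a, b => if a = 1 ∨ b = 1 then 1 else 0

open scoped Classical in
/-- The value of Boolean negation. -/
def notEval (a : ℝ) : ℝ := if a = 1 then 0 else 1

/-- Terms over a type `V` of variables. -/
inductive Term (V : Type)
  | var (x : V)
  | const (r : ℝ)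
  | not (a : Term V)
  | bin (op : BinOp) (a b : Term V)

def Term.map {V W : Type} (f : V → W) : Term V → Term W
  | .var x => .var (f x)
  | .const r => .const r
  | .not a => .not (a.map f)
  | .bin op a b => .bin op (a.map f) (b.map f)

def Term.eval {V : Type} (σ : V → ℝ) : Term V → ℝ
  | .var x => σ x
  | .const r => r
  | .not a => notEval (a.eval σ)
  | .bin op a b => op.eval (a.eval σ) (b.eval σ)

/-- Differential terms: terms that may contain the derivation operator `(t)'`. -/
inductive DTerm (V : Type)
  | term (t : Term V)
  | der (t : Term V)
  | not (a : DTerm V)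
  | bin (op : BinOp) (a b : DTerm V)

def DTerm.map {V W : Type} (f : V → W) : DTerm V → DTerm W
  | .term t => .term (t.map f)
  | .der t => .der (t.map f)
  | .not a => .not (a.map f)
  | .bin op a b => .bin op (a.map f) (b.map f)

/-- `d.HasValue γ I s r`: along the trajectory `γ` on the time interval `I`, the differential term
`d` has the value `r` at time `s`. The term `(t)'` is the time derivative of `t` along `γ`. -/
def DTerm.HasValue {V : Type} (γ : ℝ → V → ℝ) (I : Set ℝ) (s : ℝ) : DTerm V → ℝ → Prop
  | .term t, r => t.eval (γ s) = r
  | .der t, r => HasDerivWithinAt (fun u => t.eval (γ u)) r I s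
  | .not a, r => ∃ x, a.HasValue γ I s x ∧ notEval x = r
  | .bin op a b, r => ∃ x y, a.HasValue γ I s x ∧ b.HasValue γ I s y ∧ op.eval x y = r

/-- Identifiers of programs: fields, local variables (including method parameters), and `this`. -/
inductive Ident
  | field (f : Name)
  | loc (v : Name)
  | self
  deriving DecidableEq

/-- Logical variables: one for every identifier of programs, the three extra variables `t` (clock),
`cll` (contract violations) and `result` (return value), and auxiliary variables, which are used
for simultaneous substitution only. -/
inductive DVar
  | prog (x : Ident)
  | t
  | cll
  | result
  | aux (i : ℕ)
  deriving DecidableEq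

/-- Valuations. -/
abbrev State := DVar → ℝ

mutual

/-- Formulas of differential dynamic logic. -/
inductive Fml
  | eq (a b : Term DVar)
  | le (a b : Term DVar)
  | not (φ : Fml)
  | and (φ ψ : Fml)
  | or (φ ψ : Fml)
  | ex (x : DVar) (φ : Fml)
  | box (α : HP) (φ : Fml)

/-- Hybrid programs. `ode l φ` is the system of the equations `x' = d`, `(x, d) ∈ l`, with
evolution domain `φ`. -/
inductive HP
  | assign (x : DVar) (a : Term DVar)
  | havoc (x : DVar)
  | choice (α β : HP)
  | star (α : HP)
  | test (φ : Fml)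
  | seq (α β : HP)
  | ode (l : List (DVar × DTerm DVar)) (φ : Fml)

end

mutual

/-- `φ.Sat σ`: the valuation `σ` is a model of `φ`. -/
def Fml.Sat : Fml → State → Prop
  | .eq a b, σ => a.eval σ = b.eval σ
  | .le a b, σ => a.eval σ ≤ b.eval σ
  | .not φ, σ => ¬ φ.Sat σ
  | .and φ ψ, σ => φ.Sat σ ∧ ψ.Sat σ
  | .or φ ψ, σ => φ.Sat σ ∨ ψ.Sat σ
  | .ex x φ, σ => ∃ r : ℝ, φ.Sat (Function.update σ x r)
  | .box α φ, σ => ∀ σ', α.Run σ σ' → φ.Sat σ'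

/-- `α.Run σ σ'`: the program `α` started in `σ` may terminate in `σ'`. -/
def HP.Run : HP → State → State → Prop
  | .assign x a, σ, σ' => σ' = Function.update σ x (a.eval σ)
  | .havoc x, σ, σ' => ∃ r : ℝ, σ' = Function.update σ x r
  | .choice α β, σ, σ' => α.Run σ σ' ∨ β.Run σ σ'
  | .star α, σ, σ' => Relation.ReflTransGen (fun ρ ρ' => α.Run ρ ρ') σ σ'
  | .test φ, σ, σ' => σ' = σ ∧ φ.Sat σ
  | .seq α β, σ, σ' => ∃ ρ, α.Run σ ρ ∧ β.Run ρ σ'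
  | .ode l φ, σ, σ' => ∃ (T : ℝ) (γ : ℝ → State), 0 ≤ T ∧ γ 0 = σ ∧ γ T = σ' ∧
      ∀ s ∈ Set.Icc 0 T, φ.Sat (γ s) ∧
        (∀ p ∈ l, ∃ r : ℝ, p.2.HasValue γ (Set.Icc 0 T) s r ∧
          HasDerivWithinAt (fun u => γ u p.1) r (Set.Icc 0 T) s) ∧
        ∀ x : DVar, (∀ p ∈ l, p.1 ≠ x) → γ s x = σ x

end

/-- Validity: truth in every valuation. -/
def Fml.Valid (φ : Fml) : Prop := ∀ σ : State, φ.Sat σ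

/-- The truth value of `φ` depends only on the variables in `S`. -/
def Fml.OnlyRefersTo (φ : Fml) (S : Set DVar) : Prop :=
  ∀ σ τ : State, (∀ x ∈ S, σ x = τ x) → (φ.Sat σ ↔ φ.Sat τ)

/-- The formula `true`. -/
def Fml.tt : Fml := .eq (.const 0) (.const 0)

/-- The formula `false`. -/
def Fml.ff : Fml := .not .tt

def Fml.imp (φ ψ : Fml) : Fml := .or (.not φ) ψ

/-- Finite conjunctions. -/
def Fml.conj : List Fml → Fml
  | [] => .tt
  | φ :: l => .and φ (Fml.conj l)

/-- Weak negation: negation, except that weak inequalities are turned around. -/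
def Fml.weakNeg : Fml → Fml
  | .le a b => .le b a
  | .and φ ψ => .or φ.weakNeg ψ.weakNeg
  | .or φ ψ => .and φ.weakNeg ψ.weakNeg
  | .not φ => φ
  | .eq a b => .not (.eq a b)
  | .ex x φ => .not (.ex x φ)
  | .box α φ => .not (.box α φ)

/-- The formula that says that a term, read as a Boolean expression, is true. -/
def Term.toFml : Term DVar → Fml
  | .bin .le a b => .le a b
  | .bin .ge a b => .le b a
  | .bin .and a b => .and a.toFml b.toFml
  | .bin .or a b => .or a.toFml b.toFml
  | .not a => .not a.toFml
  | .bin .add a b => .eq (.bin .add a b) (.const 1)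
  | .bin .sub a b => .eq (.bin .sub a b) (.const 1)
  | .bin .mul a b => .eq (.bin .mul a b) (.const 1)
  | .bin .div a b => .eq (.bin .div a b) (.const 1)
  | .var x => .eq (.var x) (.const 1)
  | .const r => .eq (.const r) (.const 1)

/-- Sequential composition of a list of programs. -/
def HP.seqs : List HP → HP
  | [] => .test .tt
  | α :: l => .seq α (HP.seqs l)

/-- The conditional `if (φ) {α} else {β}`. -/
def HP.ite (φ : Fml) (α β : HP) : HP := .choice (.seq (.test φ) α) (.seq (.test (.not φ)) β)

/-- The loop `while (φ) {α}`. -/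
def HP.loop (φ : Fml) (α : HP) : HP := .seq (.star (.seq (.test φ) α)) (.test (.not φ))

/-- `φ(e₁, …, eₙ)`: the simultaneous replacement of the variables `xs` by the terms `es` in `φ`,
expressed by assigning the terms to auxiliary variables first. -/
def Fml.inst (φ : Fml) (xs : List DVar) (es : List (Term DVar)) : Fml :=
  .box (HP.seqs (es.zipIdx.map fun p => .assign (.aux p.2) p.1))
    (.box (HP.seqs (xs.zipIdx.map fun p => .assign p.1 (.var (.aux p.2)))) φ)

/-! ## Programs of hybrid active objects -/

/-- Expressions. -/
abbrev Expr := Term Ident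

/-- Guards `e?`, `duration(e)` and `diff e`. -/
inductive Guard
  | fut (e : Expr)
  | duration (e : Expr)
  | diff (e : Expr)

/-- The callee of a method call: `this`, or an expression whose static type is the given class. -/
inductive Callee
  | this
  | obj (e : Expr) (cls : Name)

/-- Right-hand sides `e`, `new C(es)`, `e.get` and `o!m(es)`. -/
inductive Rhs
  | expr (e : Expr)
  | new (cls : Name) (args : List Expr)
  | get (e : Expr)
  | call (o : Callee) (m : Name) (args : List Expr)

/-- Statements. `await p g` carries its program-point identifier `p`; the target of an assignment is
optional. -/
inductive Stmt
  | skip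
  | loop (e : Expr) (s : Stmt)
  | ite (e : Expr) (s₁ s₂ : Stmt)
  | seq (s₁ s₂ : Stmt)
  | await (p : ℕ) (g : Guard)
  | assign (v : Option Ident) (r : Rhs)
  | duration (e : Expr)

/-- Methods, with their body `{body; return ret;}` and their contract. -/
structure MethodDecl where
  name : Name
  params : List Name
  body : Stmt
  ret : Expr
  pre : Fml
  post : Fml

/-- Physical fields `Real f = init : f' = rhs`. -/
structure PhysDecl where
  name : Name
  init : Expr
  rhs : DTerm Ident

/-- Classes: discrete fields passed as parameters, further discrete fields, physical fields, the
initial block and the methods, with the creation condition and the object invariant. -/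
structure ClassDecl where
  name : Name
  params : List Name
  fields : List Name
  phys : List PhysDecl
  init : Stmt
  methods : List MethodDecl
  creation : Fml
  inv : Fml

/-- Programs: classes and a main block. -/
structure Program where
  classes : List ClassDecl
  main : Stmt

/-- The static class of a callee; `encl` is the enclosing class (none for the main block). -/
def Callee.cls (encl : Option Name) : Callee → Option Name
  | .this => encl
  | .obj _ C => some C

/-- The statement, in class `encl`, contains a call to the method `m` of the class `C`. -/
def Stmt.Calls (encl : Option Name) (C m : Name) : Stmt → Prop
  | .loop _ s => s.Calls encl C m
  | .ite _ s₁ s₂ => s₁.Calls encl C m ∨ s₂.Calls encl C m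
  | .seq s₁ s₂ => s₁.Calls encl C m ∨ s₂.Calls encl C m
  | .assign _ (.call o m' _) => o.cls encl = some C ∧ m' = m
  | _ => False

/-- The statement contains a call `this!m(…)`. -/
def Stmt.CallsThis (m : Name) : Stmt → Prop
  | .loop _ s => s.CallsThis m
  | .ite _ s₁ s₂ => s₁.CallsThis m ∨ s₂.CallsThis m
  | .seq s₁ s₂ => s₁.CallsThis m ∨ s₂.CallsThis m
  | .assign _ (.call .this m' _) => m' = m
  | _ => False

/-- The statement contains neither `await` nor `get` nor `duration`. -/
def Stmt.Instantaneous : Stmt → Prop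
  | .loop _ s => s.Instantaneous
  | .ite _ s₁ s₂ => s₁.Instantaneous ∧ s₂.Instantaneous
  | .seq s₁ s₂ => s₁.Instantaneous ∧ s₂.Instantaneous
  | .await _ _ => False
  | .duration _ => False
  | .assign _ (.get _) => False
  | _ => True

/-- The list of the statements that a sequence consists of. -/
def Stmt.parts : Stmt → List Stmt
  | .seq s₁ s₂ => s₁.parts ++ s₂.parts
  | s => [s]

/-- The leading guard of a method, if it starts with an `await`. -/
def MethodDecl.leadingGuard (d : MethodDecl) : Option Guard :=
  match d.body.parts with
  | .await _ g :: _ => some g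
  | _ => none

def ClassDecl.physNames (D : ClassDecl) : List Name := D.phys.map PhysDecl.name

def ClassDecl.fieldNames (D : ClassDecl) : List Name := D.params ++ D.fields ++ D.physNames

/-- The logical variables of the fields of a class. -/
def ClassDecl.fieldVars (D : ClassDecl) : Set DVar :=
  {x | ∃ f ∈ D.fieldNames, x = .prog (.field f)}

/-- The logical variables of the parameters of a method. -/
def MethodDecl.paramVars (d : MethodDecl) : Set DVar :=
  {x | ∃ v ∈ d.params, x = .prog (.loc v)}

def Program.findClass (P : Program) (C : Name) : Option ClassDecl :=
  P.classes.find? fun D => D.name == C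

def ClassDecl.findMethod (D : ClassDecl) (m : Name) : Option MethodDecl :=
  D.methods.find? fun d => d.name == m

def Program.HasClass (P : Program) (C : Name) : Prop := ∃ D ∈ P.classes, D.name = C

def Program.HasMethod (P : Program) (C m : Name) : Prop :=
  ∃ D ∈ P.classes, D.name = C ∧ ∃ d ∈ D.methods, d.name = m

/-- The standing conventions on programs: class names are unique, method names are unique within a
class, only declared methods are called, and every specification refers only to the variables
that it may refer to. -/
structure Program.WellFormed (P : Program) : Prop where
  classes_nodup : (P.classes.map ClassDecl.name).Nodup
  methods_nodup : ∀ D ∈ P.classes, (D.methods.map MethodDecl.name).Nodup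
  main_calls : ∀ C m, P.main.Calls none C m → P.HasMethod C m
  init_calls : ∀ D ∈ P.classes, ∀ C m, D.init.Calls (some D.name) C m → P.HasMethod C m
  body_calls : ∀ D ∈ P.classes, ∀ d ∈ D.methods, ∀ C m,
    d.body.Calls (some D.name) C m → P.HasMethod C m
  creation_scope : ∀ D ∈ P.classes, D.creation.OnlyRefersTo D.fieldVars
  inv_scope : ∀ D ∈ P.classes, D.inv.OnlyRefersTo D.fieldVars
  pre_scope : ∀ D ∈ P.classes, ∀ d ∈ D.methods, d.pre.OnlyRefersTo d.paramVars
  post_scope : ∀ D ∈ P.classes, ∀ d ∈ D.methods,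
    d.post.OnlyRefersTo (insert DVar.result D.fieldVars)

/-- The method `m` of the class `C` is a controller: (1) it starts with an `await`, (2) it contains
no other suspension and neither `get` nor `duration`, (3) it ends with a recursive call, (4) apart
from this recursive call, it is called from the initial block of `C` and from nowhere else. -/
def Program.IsController (P : Program) (C m : Name) : Prop :=
  (∃ D ∈ P.classes, D.name = C ∧ D.init.CallsThis m ∧
    ∃ d ∈ D.methods, d.name = m ∧ ∃ p g mid v args,
      d.body.parts = .await p g :: (mid ++ [.assign v (.call .this m args)]) ∧
      ∀ s ∈ mid, s.Instantaneous ∧ ¬ s.Calls (some C) C m) ∧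
  ¬ P.main.Calls none C m ∧
  ∀ D ∈ P.classes,
    (D.init.Calls (some D.name) C m → D.name = C) ∧
    ∀ d ∈ D.methods, d.body.Calls (some D.name) C m → D.name = C ∧ d.name = m

/-! ## The proof obligation scheme -/

/-- The translation of expressions into terms. -/
def Expr.trans (e : Expr) : Term DVar := e.map .prog

/-- The translation of Boolean expressions into formulas. -/
def Expr.fml (e : Expr) : Fml := (Expr.trans e).toFml

/-- The external trigger of a guard. -/
def Guard.trigger : Guard → Fml
  | .diff e => e.fml
  | .duration e => .le e.trans (.var .t)
  | .fut _ => .ff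

/-- The external trigger of the leading guard of a method. -/
def MethodDecl.trigger (d : MethodDecl) : Fml :=
  match d.leadingGuard with
  | some g => g.trigger
  | none => .ff

/-- The arguments of post-region generators: the constructor, the methods, and the program-point
identifiers of the `await` statements of a class. -/
inductive Point
  | init (C : Name)
  | method (C m : Name)
  | await (C : Name) (p : ℕ)

def Point.cls : Point → Name
  | .init C => C
  | .method C _ => C
  | .await C _ => C

/-- Post-region generators. -/
abbrev Generator := Point → Fml

open scoped Classical in
/-- The controllers of a class, in the order of declaration. -/
def Program.controllers (P : Program) (C : Name) : List MethodDecl :=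
  match P.findClass C with
  | some D => D.methods.filter fun d => decide (P.IsController C d.name)
  | none => []

/-- Structurally controlled regions: the conjunction of the weakly negated external triggers of all
controllers of the class. -/
def Program.ctrlGenerator (P : Program) : Generator := fun x =>
  Fml.conj ((P.controllers x.cls).map fun d => d.trigger.weakNeg)

/-- The dynamics of a class. -/
def ClassDecl.ode (D : ClassDecl) : List (DVar × DTerm DVar) :=
  D.phys.map fun f => (.prog (.field f.name), f.rhs.map .prog)

/-- The program `{ode, t' = 1 & ψ}`. -/
def ClassDecl.evolve (D : ClassDecl) (ψ : Fml) : HP :=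
  .ode (D.ode ++ [(.t, .term (.const 1))]) ψ

/-- The formula `pr(ψ) = inv ∧ [t := 0; {ode, t' = 1 & ψ}] inv`. -/
def ClassDecl.pr (D : ClassDecl) (ψ : Fml) : Fml :=
  .and D.inv (.box (.seq (.assign .t (.const 0)) (D.evolve ψ)) D.inv)

/-- The statement `cll := 1`, which fails the analysis. -/
def HP.fail : HP := .assign .cll (.const 1)

def ClassDecl.havoc (D : ClassDecl) : HP :=
  HP.seqs (D.fieldNames.map fun f => .havoc (.prog (.field f)))

def ClassDecl.havocPhys (D : ClassDecl) : HP :=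
  HP.seqs (D.physNames.map fun f => .havoc (.prog (.field f)))

/-- `{?φ} ∪ {?¬φ; fail}` -/
def HP.check (φ : Fml) : HP := .choice (.test φ) (.seq (.test (.not φ)) .fail)

/-- `v := *`, if there is a target `v`. -/
def havocTarget : Option Ident → HP
  | some v => .havoc (.prog v)
  | none => .test .tt

/-- The instantiated precondition of the method `m` of the class `C`. -/
def Program.preOf (P : Program) (C : Option Name) (m : Name) (args : List Expr) : Fml :=
  match (C.bind P.findClass).bind (fun D => D.findMethod m) with
  | some d => d.pre.inst (d.params.map fun v => .prog (.loc v)) (args.map Expr.trans)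
  | none => .tt

/-- The instantiated creation condition of the class `C`. -/
def Program.creationOf (P : Program) (C : Name) (args : List Expr) : Fml :=
  match P.findClass C with
  | some D => D.creation.inst (D.params.map fun f => .prog (.field f)) (args.map Expr.trans)
  | none => .tt

/-- The translation of a guard into a formula. -/
def Guard.fml : Guard → Fml
  | .diff e => e.fml
  | _ => .tt

/-- The region in which an `await` statement with post-region `ψ` has to be safe. Only differential
guards limit it. -/
def Guard.region (ψ : Fml) : Guard → Fml
  | .diff e => .and ψ e.fml.weakNeg
  | _ => ψ

/-- The translation of the statements of the class `D` into hybrid programs. -/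
def Stmt.trans (P : Program) (Ψ : Generator) (D : ClassDecl) : Stmt → HP
  | .skip => .test .tt
  | .seq s₁ s₂ => .seq (s₁.trans P Ψ D) (s₂.trans P Ψ D)
  | .ite e s₁ s₂ => HP.ite e.fml (s₁.trans P Ψ D) (s₂.trans P Ψ D)
  | .loop e s => HP.loop e.fml (s.trans P Ψ D)
  | .assign (some v) (.expr e) => .assign (.prog v) e.trans
  | .assign none (.expr _) => .test .tt
  | .assign v (.get _) =>
      .choice
        (.seq (.test (D.pr .tt)) (.seq D.havocPhys (.seq (.test D.inv) (havocTarget v))))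
        (.seq (.seq (.test (.not (D.pr .tt))) .fail) (.seq D.havocPhys (havocTarget v)))
  | .assign v (.call o m args) =>
      .seq (HP.check (P.preOf (o.cls (some D.name)) m args)) (havocTarget v)
  | .assign v (.new C args) => .seq (HP.check (P.creationOf C args)) (havocTarget v)
  | .await p g =>
      .choice
        (.seq (.test (D.pr (g.region (Ψ (.await D.name p)))))
          (.seq D.havoc (.test (.and g.fml D.inv))))
        (.seq (.seq (.test (.not (D.pr (g.region (Ψ (.await D.name p)))))) .fail)
          (.seq D.havoc (.test g.fml)))
  | .duration e =>
      .seq (.assign .t (.const 0))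
        (.seq (HP.check (D.pr (.le (.var .t) e.trans)))
          (.seq (.assign .t (.const 0))
            (.seq (D.evolve (.le (.var .t) e.trans)) (.test (.le e.trans (.var .t))))))

/-- The code of the constructor: the initialization of the physical fields, then the initial
block. -/
def ClassDecl.constructorCode (D : ClassDecl) : Stmt :=
  D.phys.foldr (fun f s => .seq (.assign (some (.field f.name)) (.expr f.init)) s) D.init

/-- The formula `cll ≐ 0`. -/
def Fml.noFail : Fml := .eq (.var .cll) (.const 0)

/-- The proof obligation of the constructor. -/
def Program.initObligation (P : Program) (Ψ : Generator) (D : ClassDecl) : Fml :=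
  .imp (.and D.creation .noFail)
    (.box (D.constructorCode.trans P Ψ D) (.and .noFail (D.pr (Ψ (.init D.name)))))

/-- The proof obligation of a method. -/
def Program.methodObligation (P : Program) (Ψ : Generator) (D : ClassDecl) (d : MethodDecl) :
    Fml :=
  .imp (.and D.inv (.and d.pre .noFail))
    (.box (.seq (d.body.trans P Ψ D) (.assign .result d.ret.trans))
      (.and .noFail (.and d.post (D.pr (Ψ (.method D.name d.name))))))

/-- The blocks of a class: its constructor and its methods. -/
inductive Block
  | init
  | method (m : Name)

def Program.HasBlock (P : Program) (C : Name) : Block → Prop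
  | .init => P.HasClass C
  | .method m => P.HasMethod C m

/-- The block `b` of the class `C` calls the method `m` of the class `C`. -/
def Program.BlockCalls (P : Program) (C : Name) (b : Block) (m : Name) : Prop :=
  ∃ D ∈ P.classes, D.name = C ∧
    match b with
    | .init => D.init.Calls (some C) C m
    | .method k => ∃ d ∈ D.methods, d.name = k ∧ d.body.Calls (some C) C m

/-- The proof obligation of a block for the generator `Ψ` (`true` for undeclared blocks). -/
def Program.obligation (P : Program) (Ψ : Generator) (C : Name) (b : Block) : Fml :=
  match P.findClass C with
  | none => .tt
  | some D =>
    match b with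
    | .init => P.initObligation Ψ D
    | .method m =>
      match D.findMethod m with
      | none => .tt
      | some d => P.methodObligation Ψ D d

/-- The proof obligation of a block for structurally controlled regions. -/
def Program.ctrlObligation (P : Program) (C : Name) (b : Block) : Fml :=
  P.obligation P.ctrlGenerator C b

/-- The class `C` is verified with structurally controlled regions: the proof obligations of its
constructor and of all its methods are valid. -/
def Program.Verified (P : Program) (C : Name) : Prop :=
  ∀ b, P.HasBlock C b → (P.ctrlObligation C b).Valid

/-! ## Removing and adding methods -/

/-- Replace every call to the method `m` of the class `C` by `skip`. -/
def Stmt.removeCalls (encl : Option Name) (C m : Name) : Stmt → Stmt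
  | .loop e s => .loop e (s.removeCalls encl C m)
  | .ite e s₁ s₂ => .ite e (s₁.removeCalls encl C m) (s₂.removeCalls encl C m)
  | .seq s₁ s₂ => .seq (s₁.removeCalls encl C m) (s₂.removeCalls encl C m)
  | .assign v (.call o m' args) =>
      if o.cls encl = some C ∧ m' = m then .skip else .assign v (.call o m' args)
  | s => s

/-- Remove the method `m` of the class `C`, and all calls to it. -/
def Program.remove (P : Program) (C m : Name) : Program where
  main := P.main.removeCalls none C m
  classes := P.classes.map fun D =>
    { D with
      init := D.init.removeCalls (some D.name) C m
      methods := (D.methods.filter fun d => !(D.name == C && d.name == m)).map fun d =>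
        { d with body := d.body.removeCalls (some D.name) C m } }

/-- Add the method `d` to the class `C`. -/
def Program.add (P : Program) (C : Name) (d : MethodDecl) : Program where
  main := P.main
  classes := P.classes.map fun D =>
    if D.name = C then { D with methods := D.methods ++ [d] } else D

/-- After the change of `P` into `Q`, the block `b` of `C` has to be reproven: its proof obligation
is not the one that has been proven before. -/
def NeedsReproof (P Q : Program) (C : Name) (b : Block) : Prop :=
  Q.ctrlObligation C b ≠ P.ctrlObligation C b

/-- Every method starts with an `await` statement with a differential guard. -/
def Program.SuspensionLeading (P : Program) : Prop :=
  ∀ D ∈ P.classes, ∀ d ∈ D.methods, ∃ e, d.leadingGuard = some (.diff e)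

/-- The change of `P` into `Q` turns no method of `C` into a controller. -/
def NoNewController (P Q : Program) (C : Name) : Prop :=
  ∀ k, Q.IsController C k → P.IsController C k

end HABS

end

namespace HABS

/-! ## Syntactic lemmas -/

-- An obligation depends on the rest of the program in two ways only: through the specifications of
-- the methods it calls and the classes it creates, and through the regions, which are determined by
-- the list of triggers of the controllers. The statements about reproving are therefore syntactic.
-- If a controller is removed and none appears, the controller list becomes strictly shorter. Since
-- `Fml.conj` remembers the length of its list, every post-region, and hence every obligation,
-- changes. If a removed method is not a controller and none appears, the triggers stay the same.
-- Then an obligation changes exactly when a call is removed, because a call translates to a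
-- sequence and `skip` to a test. Adding a method that calls no controller leaves the controllers as
-- they were: a controller has to be called from the initial block, which cannot call a method that
-- was not yet declared.
--
-- The validity claim of the second item needs a semantic argument, because removing a
-- non-controller may also remove the calls that kept another method from being a controller. Old
-- controllers survive (`Program.IsController.remove`), so regions can only shrink, and `pr` becomes
-- easier to satisfy. However, `pr` occurs in the translation both as a test and as a negated test,
-- so the program itself changes: the branch that assumes the invariant is entered more often.
-- `Stmt.sim_trans` compares the two translations up to `cll`. Each run for the smaller regions is
-- matched by a run for the larger regions that may record additional failures. As the old
-- obligation rules out failures, the matching run ends in the very same state (`Fml.box_of_sim`).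
-- Changing `cll` along a run is harmless because no other part of a translation reads it.
--
-- That reproving is unavoidable is shown by a tank whose level grows at unit rate and must not
-- exceed `1`. With the controller, the region itself is the invariant. Without it, the region is
-- trivial and the level passes `1`, whatever block has just terminated.

theorem Stmt.CallsThis.calls {C m : Name} {s : Stmt} (h : s.CallsThis m) :
    s.Calls (some C) C m := by
  induction s with
  | skip => exact h
  | loop e s ih => exact ih h
  | ite e s₁ s₂ ih₁ ih₂ => exact h.imp ih₁ ih₂
  | seq s₁ s₂ ih₁ ih₂ => exact h.imp ih₁ ih₂
  | await p g => exact h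
  | assign v r =>
    match r, h with
    | .call .this _ _, h => exact ⟨rfl, h⟩
  | duration e => exact h

theorem Stmt.calls_of_removeCalls {encl encl' : Option Name} {C m C' k : Name} {s : Stmt}
    (h : (s.removeCalls encl C m).Calls encl' C' k) : s.Calls encl' C' k := by
  induction s with
  | skip => exact h
  | loop e s ih => exact ih h
  | ite e s₁ s₂ ih₁ ih₂ => exact h.imp ih₁ ih₂
  | seq s₁ s₂ ih₁ ih₂ => exact h.imp ih₁ ih₂
  | await p g => exact h
  | assign v r =>
    cases r with
    | call o m' args =>
      simp only [Stmt.removeCalls] at h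
      split_ifs at h
      · exact h.elim
      · exact h
    | _ => exact h
  | duration e => exact h

theorem Stmt.CallsThis.removeCalls {encl : Option Name} {C m k : Name} {s : Stmt} (hk : k ≠ m)
    (h : s.CallsThis k) : (s.removeCalls encl C m).CallsThis k := by
  induction s with
  | skip => exact h
  | loop e s ih => exact ih h
  | ite e s₁ s₂ ih₁ ih₂ => exact h.imp ih₁ ih₂
  | seq s₁ s₂ ih₁ ih₂ => exact h.imp ih₁ ih₂
  | await p g => exact h
  | assign v r =>
    match r, h with
    | .call .this m' _, h =>
      have hm : m' = k := h
      simp only [Stmt.removeCalls]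
      rw [if_neg (fun h' => hk (hm.symm.trans h'.2))]
      exact h
  | duration e => exact h

theorem Stmt.Instantaneous.removeCalls {encl : Option Name} {C m : Name} {s : Stmt}
    (h : s.Instantaneous) : (s.removeCalls encl C m).Instantaneous := by
  induction s with
  | skip => exact h
  | loop e s ih => exact ih h
  | ite e s₁ s₂ ih₁ ih₂ => exact ⟨ih₁ h.1, ih₂ h.2⟩
  | seq s₁ s₂ ih₁ ih₂ => exact ⟨ih₁ h.1, ih₂ h.2⟩
  | await p g => exact h
  | assign v r =>
    cases r with
    | call o m' args =>
      simp only [Stmt.removeCalls]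
      split_ifs <;> simp [Stmt.Instantaneous]
    | _ => exact h
  | duration e => exact h

theorem Stmt.parts_removeCalls (encl : Option Name) (C m : Name) (s : Stmt) :
    (s.removeCalls encl C m).parts = s.parts.map (Stmt.removeCalls encl C m) := by
  induction s with
  | seq s₁ s₂ ih₁ ih₂ => simp [Stmt.removeCalls, Stmt.parts, ih₁, ih₂]
  | assign v r =>
    cases r with
    | call o m' args =>
      simp only [Stmt.removeCalls, Stmt.parts, List.map]
      split_ifs <;> rfl
    | _ => rfl
  | _ => rfl

theorem Stmt.removeCalls_eq_self {encl : Option Name} {C m : Name} {s : Stmt}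
    (h : ¬ s.Calls encl C m) : s.removeCalls encl C m = s := by
  induction s with
  | loop e s ih => simp only [Stmt.removeCalls, ih h]
  | ite e s₁ s₂ ih₁ ih₂ =>
    simp only [Stmt.removeCalls, ih₁ (fun h' => h (Or.inl h')), ih₂ (fun h' => h (Or.inr h'))]
  | seq s₁ s₂ ih₁ ih₂ =>
    simp only [Stmt.removeCalls, ih₁ (fun h' => h (Or.inl h')), ih₂ (fun h' => h (Or.inr h'))]
  | assign v r =>
    cases r with
    | call o m' args =>
      simp only [Stmt.removeCalls]
      exact if_neg h
    | _ => rfl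
  | _ => rfl

/-- The translation changes if a call is removed. -/
theorem Stmt.trans_removeCalls_ne {P Q : Program} {Φ Ψ : Generator} {D D' : ClassDecl}
    {encl : Option Name} {C m : Name} {s : Stmt} (h : s.Calls encl C m) :
    (s.removeCalls encl C m).trans Q Φ D' ≠ s.trans P Ψ D := by
  induction s with
  | skip => exact h.elim
  | loop e s ih =>
    intro heq
    simp only [Stmt.removeCalls, Stmt.trans, HP.loop, HP.seq.injEq, HP.star.injEq] at heq
    exact ih h heq.1.2
  | ite e s₁ s₂ ih₁ ih₂ =>
    intro heq
    simp only [Stmt.removeCalls, Stmt.trans, HP.ite, HP.seq.injEq, HP.choice.injEq] at heq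
    exact h.elim (fun h => ih₁ h heq.1.2) (fun h => ih₂ h heq.2.2)
  | seq s₁ s₂ ih₁ ih₂ =>
    intro heq
    simp only [Stmt.removeCalls, Stmt.trans, HP.seq.injEq] at heq
    exact h.elim (fun h => ih₁ h heq.1) (fun h => ih₂ h heq.2)
  | await p g => exact h.elim
  | assign v r =>
    cases r with
    | call o m' args =>
      simp only [Stmt.removeCalls]
      rw [if_pos (show o.cls encl = some C ∧ m' = m from h)]
      simp [Stmt.trans]
    | _ => exact h.elim
  | duration e => exact h.elim

/-- The translation depends on the program only through the specifications of the classes that are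
instantiated and the methods that are called. -/
theorem Stmt.trans_congr {P Q : Program} {Ψ : Generator} {D : ClassDecl} (i : Stmt)
    (ms : List MethodDecl)
    (hnew : ∀ C args, Q.creationOf C args = P.creationOf C args) {s : Stmt}
    (hcall : ∀ C m, s.Calls (some D.name) C m →
      ∀ args, Q.preOf (some C) m args = P.preOf (some C) m args) :
    s.trans Q Ψ { D with init := i, methods := ms } = s.trans P Ψ D := by
  induction s with
  | skip => rfl
  | loop e s ih => simp only [Stmt.trans, ih hcall]
  | ite e s₁ s₂ ih₁ ih₂ =>
    simp only [Stmt.trans, ih₁ fun C m h => hcall C m (Or.inl h),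
      ih₂ fun C m h => hcall C m (Or.inr h)]
  | seq s₁ s₂ ih₁ ih₂ =>
    simp only [Stmt.trans, ih₁ fun C m h => hcall C m (Or.inl h),
      ih₂ fun C m h => hcall C m (Or.inr h)]
  | await p g => rfl
  | assign v r =>
    cases r with
    | expr e => cases v <;> rfl
    | new C args => simp only [Stmt.trans, hnew]
    | get e => simp only [Stmt.trans]; rfl
    | call o m args =>
      simp only [Stmt.trans]
      cases o with
      | this => simp only [Callee.cls]; rw [hcall D.name m ⟨rfl, rfl⟩ args]
      | obj e C => simp only [Callee.cls]; rw [hcall C m ⟨rfl, rfl⟩ args]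
  | duration e => rfl

/-- The terminating `Fml.tt` is an equation and never a conjunction, so the end of the list can be
read off. This makes a change in the number of controllers visible in the formula. -/
theorem Fml.length_eq_of_conj_eq {l l' : List Fml} (h : Fml.conj l = Fml.conj l') :
    l.length = l'.length := by
  induction l generalizing l' with
  | nil =>
    cases l' with
    | nil => rfl
    | cons a l' => simp [Fml.conj, Fml.tt] at h
  | cons a l ih =>
    cases l' with
    | nil => simp [Fml.conj, Fml.tt] at h
    | cons b l' =>
      simp only [Fml.conj, Fml.and.injEq] at h
      simp [ih h.2]

theorem Fml.sat_conj {l : List Fml} {σ : State} : (Fml.conj l).Sat σ ↔ ∀ φ ∈ l, φ.Sat σ := by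
  induction l with
  | nil => simp [Fml.conj, Fml.tt, Fml.Sat]
  | cons a l ih => simp [Fml.conj, Fml.Sat, ih]

/-! ## Declarations -/

theorem find?_eq_some_of_nodup {α : Type} {f : α → Name} {l : List α} (hl : (l.map f).Nodup)
    {a : α} (ha : a ∈ l) : l.find? (fun x => f x == f a) = some a := by
  induction l with
  | nil => cases ha
  | cons b l ih =>
    simp only [List.map_cons, List.nodup_cons] at hl
    rcases List.mem_cons.1 ha with rfl | ha'
    · simp
    · have hne : f b ≠ f a := fun h => hl.1 (h ▸ List.mem_map_of_mem ha')
      rw [List.find?_cons_of_neg (by simpa using hne)]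
      exact ih hl.2 ha'

theorem Program.WellFormed.findClass {P : Program} (hP : P.WellFormed) {D : ClassDecl}
    (hD : D ∈ P.classes) : P.findClass D.name = some D :=
  find?_eq_some_of_nodup hP.classes_nodup hD

theorem Program.WellFormed.findMethod {P : Program} (hP : P.WellFormed) {D : ClassDecl}
    (hD : D ∈ P.classes) {d : MethodDecl} (hd : d ∈ D.methods) : D.findMethod d.name = some d :=
  find?_eq_some_of_nodup (hP.methods_nodup D hD) hd

theorem Program.mem_of_findClass {P : Program} {C : Name} {D : ClassDecl}
    (h : P.findClass C = some D) : D ∈ P.classes ∧ D.name = C :=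
  ⟨List.mem_of_find?_eq_some h, by simpa using List.find?_some h⟩

theorem ClassDecl.mem_of_findMethod {D : ClassDecl} {m : Name} {d : MethodDecl}
    (h : D.findMethod m = some d) : d ∈ D.methods ∧ d.name = m :=
  ⟨List.mem_of_find?_eq_some h, by simpa using List.find?_some h⟩

theorem Program.WellFormed.eq_of_name_eq {P : Program} (hP : P.WellFormed) {D D' : ClassDecl}
    (hD : D ∈ P.classes) (hD' : D' ∈ P.classes) (h : D'.name = D.name) : D' = D :=
  List.inj_on_of_nodup_map hP.classes_nodup hD' hD h

theorem Program.WellFormed.hasMethod_iff {P : Program} (hP : P.WellFormed) {D : ClassDecl}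
    (hD : D ∈ P.classes) {k : Name} : P.HasMethod D.name k ↔ ∃ d ∈ D.methods, d.name = k := by
  constructor
  · rintro ⟨D', hD', hn, d, hd, hk⟩
    rw [hP.eq_of_name_eq hD hD' hn] at hd
    exact ⟨d, hd, hk⟩
  · rintro ⟨d, hd, hk⟩
    exact ⟨D, hD, rfl, d, hd, hk⟩

-- How obligations depend on controllers and regions

theorem Program.controllers_of_findClass {P : Program} {C : Name} {D : ClassDecl}
    (h : P.findClass C = some D) :
    P.controllers C = D.methods.filter fun d => @decide (P.IsController C d.name)
      (Classical.propDecidable _) := by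
  simp only [Program.controllers, h]

theorem Program.ctrlObligation_init {P : Program} {C : Name} {D : ClassDecl}
    (h : P.findClass C = some D) :
    P.ctrlObligation C .init = P.initObligation P.ctrlGenerator D := by
  simp only [Program.ctrlObligation, Program.obligation, h]

theorem Program.ctrlObligation_method {P : Program} {C m : Name} {D : ClassDecl} {d : MethodDecl}
    (h : P.findClass C = some D) (hm : D.findMethod m = some d) :
    P.ctrlObligation C (.method m) = P.methodObligation P.ctrlGenerator D d := by
  simp only [Program.ctrlObligation, Program.obligation, h, hm]

theorem Program.ctrlGenerator_congr {P Q : Program} {C : Name}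
    (h : (Q.controllers C).map MethodDecl.trigger = (P.controllers C).map MethodDecl.trigger)
    {x : Point} (hx : x.cls = C) : Q.ctrlGenerator x = P.ctrlGenerator x := by
  have h' := congrArg (List.map Fml.weakNeg) h
  simp only [List.map_map] at h'
  simp only [Program.ctrlGenerator, hx]
  exact congrArg Fml.conj h'

/-- The translation depends only on the post-regions of the points of the class. -/
theorem Stmt.trans_congr_generator {P : Program} {Φ Ψ : Generator} {D : ClassDecl}
    (h : ∀ p, Φ (.await D.name p) = Ψ (.await D.name p)) (s : Stmt) :
    s.trans P Φ D = s.trans P Ψ D := by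
  induction s with
  | skip => rfl
  | loop e s ih => simp only [Stmt.trans, ih]
  | ite e s₁ s₂ ih₁ ih₂ => simp only [Stmt.trans, ih₁, ih₂]
  | seq s₁ s₂ ih₁ ih₂ => simp only [Stmt.trans, ih₁, ih₂]
  | await p g => simp only [Stmt.trans, h]
  | assign v r =>
    cases r with
    | expr e => cases v <;> rfl
    | _ => simp only [Stmt.trans]
  | duration e => rfl

/-- Both sides have the same prefix of initializing assignments, which cancels. One direction
carries equality of obligations over, the other detects a removed call in the initial block. -/
theorem ClassDecl.constructorCode_trans_eq_iff {P Q : Program} {Φ Ψ : Generator}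
    {D D' : ClassDecl} (h : D'.phys = D.phys) :
    D'.constructorCode.trans Q Φ D' = D.constructorCode.trans P Ψ D ↔
      D'.init.trans Q Φ D' = D.init.trans P Ψ D := by
  have key : ∀ l : List PhysDecl,
      (l.foldr (fun f s => .seq (.assign (some (.field f.name)) (.expr f.init)) s)
        D'.init).trans Q Φ D' =
      (l.foldr (fun f s => .seq (.assign (some (.field f.name)) (.expr f.init)) s)
        D.init).trans P Ψ D ↔ D'.init.trans Q Φ D' = D.init.trans P Ψ D := by
    intro l
    induction l with
    | nil => rfl
    | cons f l ih => simpa [Stmt.trans] using ih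
  simp only [ClassDecl.constructorCode, h]
  exact key D.phys

/-- Removal and addition alter only the initial block and the methods of a class. `pr`, the dynamics
and the creation condition read neither, hence the shape of the modified class and the closing
`rfl`. -/
theorem Program.initObligation_congr {P Q : Program} {Φ Ψ : Generator} {D : ClassDecl}
    {i : Stmt} {ms : List MethodDecl}
    (h : i.trans Q Φ { D with init := i, methods := ms } = D.init.trans P Ψ D)
    (hg : Φ (.init D.name) = Ψ (.init D.name)) :
    Q.initObligation Φ { D with init := i, methods := ms } = P.initObligation Ψ D := by
  have h' := (ClassDecl.constructorCode_trans_eq_iff (D := D)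
    (D' := { D with init := i, methods := ms }) rfl).2 h
  simp only [Program.initObligation, h', hg]
  rfl

theorem Program.methodObligation_congr {P Q : Program} {Φ Ψ : Generator} {D : ClassDecl}
    {i b : Stmt} {ms : List MethodDecl} {d : MethodDecl}
    (h : b.trans Q Φ { D with init := i, methods := ms } = d.body.trans P Ψ D)
    (hg : Φ (.method D.name d.name) = Ψ (.method D.name d.name)) :
    Q.methodObligation Φ { D with init := i, methods := ms } { d with body := b } =
      P.methodObligation Ψ D d := by
  simp only [Program.methodObligation, h, hg]
  rfl

/-! ## Removing a method -/

/-- This and `ClassDecl.remove` name the maps inside `Program.remove`, so that lookups commute with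
them through `List.find?_map`. -/
def MethodDecl.remove (encl : Option Name) (C m : Name) (d : MethodDecl) : MethodDecl :=
  { d with body := d.body.removeCalls encl C m }

def ClassDecl.remove (C m : Name) (D : ClassDecl) : ClassDecl :=
  { D with
    init := D.init.removeCalls (some D.name) C m
    methods := (D.methods.filter fun d => !(D.name == C && d.name == m)).map
      (MethodDecl.remove (some D.name) C m) }

theorem Program.classes_remove (P : Program) (C m : Name) :
    (P.remove C m).classes = P.classes.map (ClassDecl.remove C m) := rfl

theorem Program.findClass_remove (P : Program) (C m C' : Name) :
    (P.remove C m).findClass C' = (P.findClass C').map (ClassDecl.remove C m) := by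
  simp only [Program.findClass, Program.classes_remove, List.find?_map]
  rfl

theorem ClassDecl.findMethod_remove {D : ClassDecl} {C m k : Name} (h : ¬ (D.name = C ∧ k = m)) :
    (D.remove C m).findMethod k =
      (D.findMethod k).map (MethodDecl.remove (some D.name) C m) := by
  simp only [ClassDecl.findMethod, ClassDecl.remove, List.find?_map, List.find?_filter]
  congr 1
  congr 1
  funext d
  by_cases hd : d.name = k
  · simpa [MethodDecl.remove, hd, ← not_and_or] using h
  · simp [MethodDecl.remove, hd]

theorem Program.creationOf_remove (P : Program) (C m C' : Name) (args : List Expr) :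
    (P.remove C m).creationOf C' args = P.creationOf C' args := by
  simp only [Program.creationOf, Program.findClass_remove]
  cases P.findClass C' <;> rfl

theorem Program.preOf_remove (P : Program) {C m C' k : Name} (h : ¬ (C' = C ∧ k = m))
    (args : List Expr) : (P.remove C m).preOf (some C') k args = P.preOf (some C') k args := by
  simp only [Program.preOf, Program.findClass_remove, Option.bind_some]
  cases hD : P.findClass C' with
  | none => rfl
  | some D =>
    have hn := (Program.mem_of_findClass hD).2
    simp only [Option.map_some, Option.bind_some]
    rw [ClassDecl.findMethod_remove (hn.symm ▸ h)]
    cases D.findMethod k <;> rfl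

theorem ClassDecl.mem_methods_remove {D : ClassDecl} {C m : Name} {d : MethodDecl} :
    d ∈ (D.remove C m).methods ↔ ∃ d' ∈ D.methods, ¬ (D.name = C ∧ d'.name = m) ∧
      d'.remove (some D.name) C m = d := by
  simp [ClassDecl.remove, and_assoc, imp_iff_not_or]

theorem Program.hasMethod_remove {P : Program} {C m k : Name} :
    (P.remove C m).HasMethod C k ↔ P.HasMethod C k ∧ k ≠ m := by
  constructor
  · rintro ⟨D', hD', hn, d', hd', hk⟩
    obtain ⟨D, hD, rfl⟩ := List.mem_map.1 hD'
    obtain ⟨d, hd, hne, rfl⟩ := ClassDecl.mem_methods_remove.1 hd'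
    exact ⟨⟨D, hD, hn, d, hd, hk⟩, fun h => hne ⟨hn, hk.trans h⟩⟩
  · rintro ⟨⟨D, hD, hn, d, hd, hk⟩, hne⟩
    exact ⟨D.remove C m, List.mem_map_of_mem hD, hn, d.remove (some D.name) C m,
      ClassDecl.mem_methods_remove.2 ⟨d, hd, fun h => hne (hk.symm.trans h.2), rfl⟩, hk⟩

theorem Program.HasClass.of_remove {P : Program} {C m C' : Name}
    (h : (P.remove C m).HasClass C') : P.HasClass C' := by
  obtain ⟨D', hD', hn⟩ := h
  obtain ⟨D, hD, rfl⟩ := List.mem_map.1 hD'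
  exact ⟨D, hD, hn⟩

theorem Program.HasBlock.of_remove {P : Program} {C m : Name} {b : Block}
    (h : (P.remove C m).HasBlock C b) : P.HasBlock C b := by
  cases b with
  | init => exact Program.HasClass.of_remove h
  | method k => exact (Program.hasMethod_remove.1 h).1

-- Controllers and regions under removal

/-- Removal rewrites only call assignments and turns them into `skip`, never into or out of an
`await`; the head of the body keeps its guard. -/
theorem MethodDecl.trigger_remove (encl : Option Name) (C m : Name) (d : MethodDecl) :
    (d.remove encl C m).trigger = d.trigger := by
  have : (d.remove encl C m).leadingGuard = d.leadingGuard := by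
    simp only [MethodDecl.leadingGuard, MethodDecl.remove, Stmt.parts_removeCalls]
    rcases d.body.parts with _ | ⟨s, l⟩
    · rfl
    · cases s with
      | assign v r =>
        cases r with
        | call o m' args =>
          simp only [List.map_cons, Stmt.removeCalls]
          split_ifs <;> rfl
        | _ => rfl
      | _ => rfl
  simp only [MethodDecl.trigger, this]

/-- Controllers remain controllers if another method is removed. -/
theorem Program.IsController.remove {P : Program} {C m k : Name} (h : P.IsController C k)
    (hk : k ≠ m) : (P.remove C m).IsController C k := by
  obtain ⟨⟨D, hD, hn, hi, d, hd, hdk, p, g, mid, v, args, hparts, hmid⟩, hmain, hcalls⟩ := h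
  refine ⟨⟨D.remove C m, List.mem_map_of_mem hD, hn, hi.removeCalls hk,
    d.remove (some D.name) C m,
    ClassDecl.mem_methods_remove.2 ⟨d, hd, fun h => hk (hdk.symm.trans h.2), rfl⟩, hdk, p, g,
    mid.map (Stmt.removeCalls (some D.name) C m), v, args, ?_, ?_⟩, ?_, ?_⟩
  -- The final recursive call goes to `k`, not to `m`, so it is not replaced by `skip`.
  · simp [MethodDecl.remove, Stmt.parts_removeCalls, hparts, Stmt.removeCalls, hk]
  · intro s hs
    obtain ⟨s', hs', rfl⟩ := List.mem_map.1 hs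
    exact ⟨(hmid s' hs').1.removeCalls, fun h => (hmid s' hs').2 (Stmt.calls_of_removeCalls h)⟩
  · exact fun h => hmain (Stmt.calls_of_removeCalls h)
  · intro D' hD'
    obtain ⟨D, hD, rfl⟩ := List.mem_map.1 hD'
    refine ⟨fun h => (hcalls D hD).1 (Stmt.calls_of_removeCalls h), fun d' hd' h => ?_⟩
    obtain ⟨d, hd, -, rfl⟩ := ClassDecl.mem_methods_remove.1 hd'
    exact (hcalls D hD).2 d hd (Stmt.calls_of_removeCalls h)

theorem Program.mem_controllers {P : Program} {C : Name} {D : ClassDecl}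
    (h : P.findClass C = some D) {d : MethodDecl} :
    d ∈ P.controllers C ↔ d ∈ D.methods ∧ P.IsController C d.name := by
  simp [Program.controllers_of_findClass h]

open scoped Classical in
-- Both controller lists become filters of the same list `D.methods`, which makes them comparable
-- entry by entry.
theorem Program.controllers_remove {P : Program} {C m : Name} {D : ClassDecl}
    (h : P.findClass C = some D) :
    (P.remove C m).controllers C = (D.methods.filter fun d =>
      decide ((P.remove C m).IsController C d.name ∧ d.name ≠ m)).map
        (MethodDecl.remove (some D.name) C m) := by
  have hn := (Program.mem_of_findClass h).2
  rw [Program.controllers_of_findClass (D := D.remove C m)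
    (by rw [Program.findClass_remove, h]; rfl)]
  simp only [ClassDecl.remove, List.filter_map, List.filter_filter]
  congr 1
  apply List.filter_congr
  intro d _
  rw [Bool.eq_iff_iff]
  simp only [hn, Bool.and_eq_true, decide_eq_true_eq, Function.comp_apply]
  simp [show (d.remove (some C) C m).name = d.name from rfl]

theorem Program.controllers_remove_trigger {P : Program} {C m : Name} {D : ClassDecl}
    (h : P.findClass C = some D) (hm : ¬ P.IsController C m)
    (hnew : NoNewController P (P.remove C m) C) :
    ((P.remove C m).controllers C).map MethodDecl.trigger =
      (P.controllers C).map MethodDecl.trigger := by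
  rw [Program.controllers_remove h, Program.controllers_of_findClass h, List.map_map]
  have : MethodDecl.trigger ∘ MethodDecl.remove (some D.name) C m = MethodDecl.trigger :=
    funext fun d => MethodDecl.trigger_remove _ _ _ d
  rw [this]
  congr 1
  apply List.filter_congr
  intro d _
  simp only [decide_eq_decide]
  constructor
  · exact fun h => hnew _ h.1
  · intro hc
    have hne : d.name ≠ m := fun h => hm (h ▸ hc)
    exact ⟨hc.remove hne, hne⟩

/-- Without new controllers the filter after removal is a sublist of the old one. Equal length would
force equality, but the declaration of `m` is only in the old one. -/
theorem Program.length_controllers_remove_lt {P : Program} {C m : Name} {D : ClassDecl}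
    (h : P.findClass C = some D) (hm : P.IsController C m) (hmeth : ∃ d ∈ D.methods, d.name = m)
    (hnew : NoNewController P (P.remove C m) C) :
    ((P.remove C m).controllers C).length < (P.controllers C).length := by
  classical
  rw [Program.controllers_remove h, Program.controllers_of_findClass h, List.length_map]
  have hsub : (D.methods.filter fun d =>
      decide ((P.remove C m).IsController C d.name ∧ d.name ≠ m)).Sublist
      (D.methods.filter fun d => decide (P.IsController C d.name)) :=
    List.monotone_filter_right _ fun d hd => by
      simp only [decide_eq_true_eq] at hd ⊢
      exact hnew _ hd.1
  refine lt_of_le_of_ne hsub.length_le fun heq => ?_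
  obtain ⟨d, hd, rfl⟩ := hmeth
  have hmem : d ∈ D.methods.filter fun d => decide (P.IsController C d.name) := by
    simp [hd, hm]
  rw [← hsub.eq_of_length heq] at hmem
  simp at hmem

/-- After the removal of a controller, every block has to be reproven. -/
theorem needsReproof_remove_of_isController {P : Program} (hP : P.WellFormed) {C m : Name}
    (hmeth : P.HasMethod C m) (hm : P.IsController C m)
    (hnew : NoNewController P (P.remove C m) C) {b : Block} (hb : (P.remove C m).HasBlock C b) :
    NeedsReproof P (P.remove C m) C b := by
  obtain ⟨D, hD, rfl, hdm⟩ := hmeth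
  have hfind := hP.findClass hD
  have hfind' : (P.remove D.name m).findClass D.name = some (D.remove D.name m) := by
    rw [Program.findClass_remove, hfind]; rfl
  have hlt := Program.length_controllers_remove_lt hfind hm hdm hnew
  have hgen : ∀ x : Point, x.cls = D.name →
      (P.remove D.name m).ctrlGenerator x ≠ P.ctrlGenerator x := by
    intro x hx heq
    simp only [Program.ctrlGenerator, hx] at heq
    have := Fml.length_eq_of_conj_eq heq
    simp only [List.length_map] at this
    omega
  intro heq
  cases b with
  | init =>
    rw [Program.ctrlObligation_init hfind, Program.ctrlObligation_init hfind'] at heq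
    simp only [Program.initObligation, Fml.imp, ClassDecl.pr, ClassDecl.evolve, Fml.or.injEq,
      Fml.box.injEq, Fml.and.injEq, HP.seq.injEq, HP.ode.injEq] at heq
    -- Injectivity of the formula constructors isolates the evolution domain in the final `pr`,
    -- which is the post-region. Every block has such a `pr`, even one without any `await`.
    exact hgen (.init D.name) rfl heq.2.2.2.2.1.2.2
  | method k =>
    obtain ⟨hk, hne⟩ := Program.hasMethod_remove.1 hb
    obtain ⟨d, hd, rfl⟩ := (hP.hasMethod_iff hD).1 hk
    have hfm := hP.findMethod hD hd
    have hfm' : (D.remove D.name m).findMethod d.name =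
        some (d.remove (some D.name) D.name m) := by
      rw [ClassDecl.findMethod_remove (fun h => hne h.2), hfm]; rfl
    rw [Program.ctrlObligation_method hfind hfm, Program.ctrlObligation_method hfind' hfm'] at heq
    simp only [Program.methodObligation, Fml.imp, ClassDecl.pr, ClassDecl.evolve, Fml.or.injEq,
      Fml.box.injEq, Fml.and.injEq, HP.seq.injEq, HP.ode.injEq] at heq
    exact hgen (.method D.name d.name) rfl heq.2.2.2.2.2.1.2.2

theorem Stmt.trans_remove {P : Program} {Ψ : Generator} {D : ClassDecl} {C m : Name} {s : Stmt}
    (h : ¬ s.Calls (some D.name) C m) :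
    (s.removeCalls (some D.name) C m).trans (P.remove C m) Ψ (D.remove C m) = s.trans P Ψ D := by
  rw [Stmt.removeCalls_eq_self h]
  exact Stmt.trans_congr _ _ (fun _ _ => P.creationOf_remove C m _ _)
    fun C' k hc args => P.preOf_remove (fun he => by
      obtain ⟨rfl, rfl⟩ := he
      exact h hc) args

/-- Blocks that do not call the removed method have the same obligations, up to the regions. -/
theorem Program.obligation_remove {P : Program} (hP : P.WellFormed) {C m : Name} (Ψ : Generator)
    {b : Block} (hb : (P.remove C m).HasBlock C b) (hc : ¬ P.BlockCalls C b m) :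
    (P.remove C m).obligation Ψ C b = P.obligation Ψ C b := by
  cases b with
  | init =>
    obtain ⟨D, hD, rfl⟩ := Program.HasClass.of_remove hb
    simp only [Program.obligation, Program.findClass_remove, hP.findClass hD, Option.map_some]
    exact Program.initObligation_congr (Stmt.trans_remove fun h => hc ⟨D, hD, rfl, h⟩) rfl
  | method k =>
    obtain ⟨⟨D, hD, rfl, d, hd, rfl⟩, hne⟩ := Program.hasMethod_remove.1 hb
    simp only [Program.obligation, Program.findClass_remove, hP.findClass hD, Option.map_some,
      ClassDecl.findMethod_remove (C := D.name) (m := m) (fun h => hne h.2), hP.findMethod hD hd]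
    exact Program.methodObligation_congr
      (Stmt.trans_remove fun h => hc ⟨D, hD, rfl, d, hd, rfl, h⟩) rfl

/-- The difference already lies in the translated body, so nothing about the regions is needed here.
-/
theorem needsReproof_remove_of_blockCalls {P : Program} (hP : P.WellFormed) {C m : Name}
    {b : Block} (hb : (P.remove C m).HasBlock C b) (hc : P.BlockCalls C b m) :
    NeedsReproof P (P.remove C m) C b := by
  intro heq
  obtain ⟨D, hD, rfl, hc⟩ := hc
  have hfind := hP.findClass hD
  have hfind' : (P.remove D.name m).findClass D.name = some (D.remove D.name m) := by
    rw [Program.findClass_remove, hfind]; rfl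
  cases b with
  | init =>
    rw [Program.ctrlObligation_init hfind, Program.ctrlObligation_init hfind'] at heq
    simp only [Program.initObligation, Fml.imp, Fml.or.injEq, Fml.box.injEq] at heq
    exact Stmt.trans_removeCalls_ne hc
      ((ClassDecl.constructorCode_trans_eq_iff (D := D) (D' := D.remove D.name m) rfl).1 heq.2.1)
  | method k =>
    obtain ⟨-, hne⟩ := Program.hasMethod_remove.1 hb
    obtain ⟨d, hd, rfl, hc⟩ := hc
    have hfm := hP.findMethod hD hd
    have hfm' : (D.remove D.name m).findMethod d.name =
        some (d.remove (some D.name) D.name m) := by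
      rw [ClassDecl.findMethod_remove (fun h => hne h.2), hfm]; rfl
    rw [Program.ctrlObligation_method hfind hfm, Program.ctrlObligation_method hfind' hfm'] at heq
    simp only [Program.methodObligation, Fml.imp, Fml.or.injEq, Fml.box.injEq,
      HP.seq.injEq] at heq
    exact Stmt.trans_removeCalls_ne hc heq.2.1.1

/-- An obligation depends only on the regions of the points of the class. -/
theorem Program.obligation_congr_generator {P : Program} {Φ Ψ : Generator} {C : Name}
    (h : ∀ x : Point, x.cls = C → Φ x = Ψ x) (b : Block) :
    P.obligation Φ C b = P.obligation Ψ C b := by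
  cases hD : P.findClass C with
  | none => simp only [Program.obligation, hD]
  | some D =>
    have hn := (Program.mem_of_findClass hD).2
    have htr := Stmt.trans_congr_generator (P := P) (D := D) (Φ := Φ) (Ψ := Ψ)
      fun p => h _ hn
    cases b with
    | init =>
      simp only [Program.obligation, hD, Program.initObligation, htr, h (.init D.name) hn]
    | method k =>
      simp only [Program.obligation, hD]
      cases hd : D.findMethod k with
      | none => rfl
      | some d =>
        simp only [Program.methodObligation, htr, h (.method D.name d.name) hn]

/-- The change is split in two: the program changes while the generator is kept, then the generator
changes while the program is kept. -/
theorem not_needsReproof_remove {P : Program} (hP : P.WellFormed) {C m : Name}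
    (hm : ¬ P.IsController C m) (hnew : NoNewController P (P.remove C m) C)
    {b : Block} (hb : (P.remove C m).HasBlock C b) (hc : ¬ P.BlockCalls C b m) :
    ¬ NeedsReproof P (P.remove C m) C b := by
  obtain ⟨D, hD, rfl⟩ : P.HasClass C := by
    cases b with
    | init => exact Program.HasClass.of_remove hb
    | method k =>
      obtain ⟨D, hD, hn, -⟩ := (Program.hasMethod_remove.1 hb).1
      exact ⟨D, hD, hn⟩
  rw [NeedsReproof, not_not, Program.ctrlObligation, Program.ctrlObligation,
    Program.obligation_remove hP _ hb hc]
  exact Program.obligation_congr_generator (fun x hx => Program.ctrlGenerator_congr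
    (Program.controllers_remove_trigger (hP.findClass hD) hm hnew) hx) b

/-! ## Adding a method -/

def ClassDecl.add (C : Name) (d : MethodDecl) (D : ClassDecl) : ClassDecl :=
  if D.name = C then { D with methods := D.methods ++ [d] } else D

theorem ClassDecl.name_add (C : Name) (d : MethodDecl) (D : ClassDecl) :
    (D.add C d).name = D.name := by
  unfold ClassDecl.add; split_ifs <;> rfl

theorem ClassDecl.init_add (C : Name) (d : MethodDecl) (D : ClassDecl) :
    (D.add C d).init = D.init := by
  unfold ClassDecl.add; split_ifs <;> rfl

theorem ClassDecl.mem_methods_add {C : Name} {d : MethodDecl} {D : ClassDecl} {d' : MethodDecl} :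
    d' ∈ (D.add C d).methods ↔ d' ∈ D.methods ∨ (D.name = C ∧ d' = d) := by
  unfold ClassDecl.add; split_ifs with h <;> simp [h]

theorem ClassDecl.add_of_name {D : ClassDecl} (d : MethodDecl) :
    D.add D.name d = { D with methods := D.methods ++ [d] } := if_pos rfl

theorem Program.classes_add (P : Program) (C : Name) (d : MethodDecl) :
    (P.add C d).classes = P.classes.map (ClassDecl.add C d) := rfl

theorem Program.mem_classes_add {P : Program} {C : Name} {d : MethodDecl} {D' : ClassDecl} :
    D' ∈ (P.add C d).classes ↔ ∃ D ∈ P.classes, D.add C d = D' := List.mem_map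

theorem Program.findClass_add (P : Program) (C : Name) (d : MethodDecl) (C' : Name) :
    (P.add C d).findClass C' = (P.findClass C').map (ClassDecl.add C d) := by
  simp only [Program.findClass, Program.classes_add, List.find?_map]
  congr 2
  funext D
  simp [ClassDecl.name_add]

/-- The new method is appended at the end and `find?` returns the first match, so freshness of its
name is not needed. -/
theorem ClassDecl.findMethod_add {D : ClassDecl} {C : Name} {d : MethodDecl} {k : Name}
    (h : ∃ d' ∈ D.methods, d'.name = k) : (D.add C d).findMethod k = D.findMethod k := by
  unfold ClassDecl.add
  split_ifs with hn
  · simp only [ClassDecl.findMethod, List.find?_append]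
    obtain ⟨d', hd', hk⟩ := h
    have : (D.methods.find? fun d => d.name == k).isSome :=
      List.find?_isSome.2 ⟨d', hd', by simpa using hk⟩
    obtain ⟨e, he⟩ := Option.isSome_iff_exists.1 this
    simp [he]
  · rfl

theorem Program.creationOf_add (P : Program) (C : Name) (d : MethodDecl) (C' : Name)
    (args : List Expr) : (P.add C d).creationOf C' args = P.creationOf C' args := by
  simp only [Program.creationOf, Program.findClass_add]
  cases P.findClass C' with
  | none => rfl
  | some D =>
    simp only [Option.map_some, ClassDecl.add]
    split_ifs <;> rfl

/-- For an undeclared method this could fail: `preOf` defaults to `Fml.tt`, and the addition might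
declare that method. -/
theorem Program.preOf_add {P : Program} (hP : P.WellFormed) (C : Name) (d : MethodDecl)
    {C' k : Name} (h : P.HasMethod C' k) (args : List Expr) :
    (P.add C d).preOf (some C') k args = P.preOf (some C') k args := by
  obtain ⟨D, hD, rfl, hk⟩ := h
  simp only [Program.preOf, Program.findClass_add, Option.bind_some, hP.findClass hD,
    Option.map_some, ClassDecl.findMethod_add hk]

theorem Program.name_notMem_of_wellFormed_add {P : Program} {D : ClassDecl} (hD : D ∈ P.classes)
    {d : MethodDecl} (h : (P.add D.name d).WellFormed) : ∀ d' ∈ D.methods, d'.name ≠ d.name := by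
  have := h.methods_nodup (D.add D.name d) (List.mem_map_of_mem hD)
  rw [ClassDecl.add_of_name] at this
  simp only [List.map_append, List.nodup_append, List.map_cons, List.map_nil, List.mem_map,
    List.mem_singleton] at this
  intro d' hd'
  exact this.2.2 _ ⟨d', hd', rfl⟩ _ rfl

/-- The hypothesis on `d` keeps old controllers from acquiring a further caller. No controller can
arise, since the added method only adds callers and is itself not called from the initial block. -/
theorem Program.isController_add_iff {P : Program} (hP : P.WellFormed) {D : ClassDecl}
    (hD : D ∈ P.classes) {d : MethodDecl} (h : (P.add D.name d).WellFormed)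
    (hd : ∀ k, P.IsController D.name k → ¬ d.body.Calls (some D.name) D.name k) {k : Name} :
    (P.add D.name d).IsController D.name k ↔ P.IsController D.name k := by
  have hfresh := Program.name_notMem_of_wellFormed_add hD h
  constructor
  · rintro ⟨⟨D', hD', hn, hi, d', hd', hk, hbody⟩, hmain, hcalls⟩
    obtain ⟨D₁, hD₁, rfl⟩ := Program.mem_classes_add.1 hD'
    rw [ClassDecl.name_add] at hn
    obtain rfl := hP.eq_of_name_eq hD hD₁ hn
    rw [ClassDecl.init_add] at hi
    have hdecl := hP.init_calls _ hD _ _ (hi.calls (C := D₁.name))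
    obtain ⟨e, he, hek⟩ := (hP.hasMethod_iff hD).1 hdecl
    rcases ClassDecl.mem_methods_add.1 hd' with hd' | ⟨-, rfl⟩
    · refine ⟨⟨D₁, hD, rfl, hi, d', hd', hk, hbody⟩, hmain, fun D₂ hD₂ => ?_⟩
      have := hcalls _ (Program.mem_classes_add.2 ⟨D₂, hD₂, rfl⟩)
      rw [ClassDecl.name_add, ClassDecl.init_add] at this
      exact ⟨this.1, fun d₂ hd₂ => this.2 d₂ (ClassDecl.mem_methods_add.2 (Or.inl hd₂))⟩
    -- Here the controller would be the added method, but the initial block calls it, so its name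
    -- was already taken in `D`.
    · exact absurd (hek.trans hk.symm) (hfresh e he)
  · intro hctrl
    have hdk := hd k hctrl
    obtain ⟨⟨D', hD', hn, hi, d', hd', hk, hbody⟩, hmain, hcalls⟩ := hctrl
    refine ⟨⟨D'.add D.name d, List.mem_map_of_mem hD', by rw [ClassDecl.name_add, hn],
      by rwa [ClassDecl.init_add], d', ClassDecl.mem_methods_add.2 (Or.inl hd'), hk, hbody⟩,
      hmain, fun D₂ hD₂ => ?_⟩
    obtain ⟨D₁, hD₁, rfl⟩ := Program.mem_classes_add.1 hD₂
    rw [ClassDecl.name_add, ClassDecl.init_add]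
    refine ⟨(hcalls D₁ hD₁).1, fun d₂ hd₂ hc => ?_⟩
    rcases ClassDecl.mem_methods_add.1 hd₂ with hd₂ | ⟨hn₁, rfl⟩
    · exact (hcalls D₁ hD₁).2 d₂ hd₂ hc
    · exact absurd (hn₁ ▸ hc) hdk

theorem Program.controllers_add {P : Program} (hP : P.WellFormed) {D : ClassDecl}
    (hD : D ∈ P.classes) {d : MethodDecl} (h : (P.add D.name d).WellFormed)
    (hd : ∀ k, P.IsController D.name k → ¬ d.body.Calls (some D.name) D.name k) :
    (P.add D.name d).controllers D.name = P.controllers D.name := by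
  have hfind := hP.findClass hD
  have hnot : ¬ P.IsController D.name d.name := by
    intro hc
    obtain ⟨D', hD', hn, -, d', hd', hk, -⟩ := hc.1
    rw [hP.eq_of_name_eq hD hD' hn] at hd'
    exact Program.name_notMem_of_wellFormed_add hD h d' hd' hk
  rw [Program.controllers_of_findClass hfind,
    Program.controllers_of_findClass (D := D.add D.name d)
      (by rw [Program.findClass_add, hfind]; rfl)]
  have key : ∀ k, (P.add D.name d).IsController D.name k ↔ P.IsController D.name k :=
    fun k => Program.isController_add_iff hP hD h hd
  simp only [ClassDecl.add_of_name, List.filter_append]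
  rw [(List.filter_eq_nil_iff (l := [d])).2, List.append_nil]
  · exact List.filter_congr fun d' _ => decide_eq_decide.2 (key d'.name)
  · intro d' hd'
    rw [List.mem_singleton.1 hd', @decide_eq_true_eq _ (Classical.propDecidable _), key]
    exact hnot

theorem ctrlObligation_add {P : Program} (hP : P.WellFormed) {C : Name} {d : MethodDecl}
    (h : (P.add C d).WellFormed)
    (hd : ∀ k, P.IsController C k → ¬ d.body.Calls (some C) C k) {b : Block}
    (hb : P.HasBlock C b) : (P.add C d).ctrlObligation C b = P.ctrlObligation C b := by
  obtain ⟨D, hD, rfl⟩ : P.HasClass C := by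
    cases b with
    | init => exact hb
    | method k =>
      obtain ⟨D, hD, hn, -⟩ := hb
      exact ⟨D, hD, hn⟩
  have hfind := hP.findClass hD
  have hfind' : (P.add D.name d).findClass D.name =
      some { D with methods := D.methods ++ [d] } := by
    rw [Program.findClass_add, hfind, ← ClassDecl.add_of_name]; rfl
  have hgen : ∀ x : Point, x.cls = D.name →
      (P.add D.name d).ctrlGenerator x = P.ctrlGenerator x :=
    fun x hx => Program.ctrlGenerator_congr (by rw [Program.controllers_add hP hD h hd]) hx
  rw [Program.ctrlObligation, Program.obligation_congr_generator hgen, Program.ctrlObligation]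
  cases b with
  | init =>
    simp only [Program.obligation, hfind, hfind']
    exact Program.initObligation_congr (Stmt.trans_congr _ _ (P.creationOf_add _ d)
      fun C' k hc => P.preOf_add hP _ d (hP.init_calls D hD C' k hc)) rfl
  | method k =>
    obtain ⟨d', hd', rfl⟩ := (hP.hasMethod_iff hD).1 hb
    have hfm' : ClassDecl.findMethod { D with methods := D.methods ++ [d] } d'.name = some d' := by
      rw [← ClassDecl.add_of_name, ClassDecl.findMethod_add ⟨d', hd', rfl⟩, hP.findMethod hD hd']
    simp only [Program.obligation, hfind, hfind', hfm', hP.findMethod hD hd']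
    exact Program.methodObligation_congr (Stmt.trans_congr _ _ (P.creationOf_add _ d)
      fun C' k hc => P.preOf_add hP _ d (hP.body_calls D hD d' hd' C' k hc)) rfl

theorem verified_add_iff {P : Program} (hP : P.WellFormed) {C : Name} (hC : P.HasClass C)
    (hver : P.Verified C) {d : MethodDecl} (h : (P.add C d).WellFormed)
    (hd : ∀ k, P.IsController C k → ¬ d.body.Calls (some C) C k) :
    (P.add C d).Verified C ↔ ((P.add C d).ctrlObligation C (.method d.name)).Valid := by
  obtain ⟨D, hD, rfl⟩ := hC
  constructor
  · exact fun hv => hv _ ⟨D.add D.name d, List.mem_map_of_mem hD, ClassDecl.name_add _ _ _, d,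
      ClassDecl.mem_methods_add.2 (Or.inr ⟨rfl, rfl⟩), rfl⟩
  · intro hv b hb
    by_cases hb' : P.HasBlock D.name b
    · rw [ctrlObligation_add hP h hd hb']
      exact hver b hb'
    · cases b with
      -- The constructor is an old block, so only the added method can be a block that `P` lacks.
      | init => exact absurd ⟨D, hD, rfl⟩ hb'
      | method k =>
        obtain ⟨D', hD', hn, d', hd', hk⟩ := hb
        obtain ⟨D₁, hD₁, rfl⟩ := Program.mem_classes_add.1 hD'
        rw [ClassDecl.name_add] at hn
        rcases ClassDecl.mem_methods_add.1 hd' with hd' | ⟨-, rfl⟩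
        · exact absurd ⟨D₁, hD₁, hn, d', hd', hk⟩ hb'
        · rw [← hk]; exact hv


/-! ## Independence of the failure flag -/

/-- The truth value of a formula does not depend on `cll`. -/
def Fml.IgnoresCll (φ : Fml) : Prop :=
  ∀ (σ : State) (c : ℝ), φ.Sat (Function.update σ .cll c) ↔ φ.Sat σ

/-- A program neither reads nor writes `cll`. -/
def HP.IgnoresCll (α : HP) : Prop :=
  ∀ σ σ' : State, α.Run σ σ' → σ' .cll = σ .cll ∧
    ∀ c, α.Run (Function.update σ .cll c) (Function.update σ' .cll c)

theorem Fml.OnlyRefersTo.ignoresCll {φ : Fml} {S : Set DVar} (h : φ.OnlyRefersTo S)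
    (hS : DVar.cll ∉ S) : φ.IgnoresCll := fun _ _ =>
  h _ _ fun _ hx => Function.update_of_ne (ne_of_mem_of_not_mem hx hS) _ _

theorem Fml.IgnoresCll.and {φ ψ : Fml} (h₁ : φ.IgnoresCll) (h₂ : ψ.IgnoresCll) :
    (Fml.and φ ψ).IgnoresCll := fun σ c => and_congr (h₁ σ c) (h₂ σ c)

theorem Fml.IgnoresCll.or {φ ψ : Fml} (h₁ : φ.IgnoresCll) (h₂ : ψ.IgnoresCll) :
    (Fml.or φ ψ).IgnoresCll := fun σ c => or_congr (h₁ σ c) (h₂ σ c)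

theorem Fml.IgnoresCll.not {φ : Fml} (h : φ.IgnoresCll) : (Fml.not φ).IgnoresCll :=
  fun σ c => not_congr (h σ c)

theorem Fml.ignoresCll_tt : Fml.tt.IgnoresCll := fun _ _ => Iff.rfl

theorem Fml.IgnoresCll.conj {l : List Fml} (h : ∀ φ ∈ l, φ.IgnoresCll) :
    (Fml.conj l).IgnoresCll := fun σ c => by
  simp only [Fml.sat_conj]
  exact forall₂_congr fun φ hφ => h φ hφ σ c

/-- One implication suffices: a second update with the original value of `cll` undoes the first, so
the converse is an instance of the same implication. -/
theorem Fml.IgnoresCll.box {α : HP} {φ : Fml} (hα : α.IgnoresCll) (hφ : φ.IgnoresCll) :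
    (Fml.box α φ).IgnoresCll := by
  have key : ∀ σ c, (Fml.box α φ).Sat σ → (Fml.box α φ).Sat (Function.update σ .cll c) := by
    intro σ c h σ' hr
    have h' := (hα _ _ hr).2 (σ .cll)
    rw [Function.update_idem, Function.update_eq_self] at h'
    exact (hφ _ _).1 (h _ h')
  refine fun σ c => ⟨fun h => ?_, key σ c⟩
  have := key _ (σ .cll) h
  rwa [Function.update_idem, Function.update_eq_self] at this

theorem Term.eval_update_of_map {V : Type} {f : V → DVar} (hf : ∀ v, f v ≠ .cll) (e : Term V)
    (σ : State) (c : ℝ) : (e.map f).eval (Function.update σ .cll c) = (e.map f).eval σ := by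
  induction e with
  | var x => exact Function.update_of_ne (hf x) _ _
  | const r => rfl
  | not a ih => simp only [Term.map, Term.eval, ih]
  | bin op a b iha ihb => simp only [Term.map, Term.eval, iha, ihb]

theorem Expr.eval_trans_update (e : Expr) (σ : State) (c : ℝ) :
    (Expr.trans e).eval (Function.update σ .cll c) = (Expr.trans e).eval σ :=
  Term.eval_update_of_map (fun _ => DVar.noConfusion) e σ c

theorem DTerm.hasValue_update_of_map {V : Type} {f : V → DVar} (hf : ∀ v, f v ≠ .cll)
    (d : DTerm V) (γ : ℝ → State) (I : Set ℝ) (s : ℝ) (c r : ℝ) :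
    (d.map f).HasValue (fun u => Function.update (γ u) .cll c) I s r ↔
      (d.map f).HasValue γ I s r := by
  induction d generalizing r with
  | term t => simp only [DTerm.map, DTerm.HasValue, Term.eval_update_of_map hf]
  | der t => simp only [DTerm.map, DTerm.HasValue, Term.eval_update_of_map hf]
  | not a ih => simp only [DTerm.map, DTerm.HasValue, ih]
  | bin op a b iha ihb => simp only [DTerm.map, DTerm.HasValue, iha, ihb]

theorem Fml.ignoresCll_eq {a b : Term DVar}
    (ha : ∀ σ c, a.eval (Function.update σ .cll c) = a.eval σ)
    (hb : ∀ σ c, b.eval (Function.update σ .cll c) = b.eval σ) : (Fml.eq a b).IgnoresCll :=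
  fun σ c => by simp only [Fml.Sat, ha, hb]

theorem Fml.ignoresCll_le {a b : Term DVar}
    (ha : ∀ σ c, a.eval (Function.update σ .cll c) = a.eval σ)
    (hb : ∀ σ c, b.eval (Function.update σ .cll c) = b.eval σ) : (Fml.le a b).IgnoresCll :=
  fun σ c => by simp only [Fml.Sat, ha, hb]

/-- Weak negation is defined by syntactic recursion and is not equivalent to negation, so both
claims are carried through one induction. -/
theorem Expr.fml_ignoresCll (e : Expr) :
    (Expr.fml e).IgnoresCll ∧ (Expr.fml e).weakNeg.IgnoresCll := by
  unfold Expr.fml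
  have hc : ∀ (r : ℝ) σ c, (Term.const r : Term DVar).eval (Function.update σ .cll c) =
      (Term.const r : Term DVar).eval σ := fun _ _ _ => rfl
  induction e with
  | var x =>
    have := Fml.ignoresCll_eq (Expr.eval_trans_update (.var x)) (hc 1)
    exact ⟨this, this.not⟩
  | const r =>
    have := Fml.ignoresCll_eq (hc r) (hc 1)
    exact ⟨this, this.not⟩
  | not a ih => exact ⟨ih.1.not, ih.1⟩
  | bin op a b iha ihb =>
    cases op with
    | le =>
      exact ⟨Fml.ignoresCll_le (Expr.eval_trans_update a) (Expr.eval_trans_update b),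
        Fml.ignoresCll_le (Expr.eval_trans_update b) (Expr.eval_trans_update a)⟩
    | ge =>
      exact ⟨Fml.ignoresCll_le (Expr.eval_trans_update b) (Expr.eval_trans_update a),
        Fml.ignoresCll_le (Expr.eval_trans_update a) (Expr.eval_trans_update b)⟩
    | and => exact ⟨iha.1.and ihb.1, iha.2.or ihb.2⟩
    | or => exact ⟨iha.1.or ihb.1, iha.2.and ihb.2⟩
    | add =>
      have := Fml.ignoresCll_eq (Expr.eval_trans_update (.bin .add a b)) (hc 1)
      exact ⟨this, this.not⟩
    | sub =>
      have := Fml.ignoresCll_eq (Expr.eval_trans_update (.bin .sub a b)) (hc 1)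
      exact ⟨this, this.not⟩
    | mul =>
      have := Fml.ignoresCll_eq (Expr.eval_trans_update (.bin .mul a b)) (hc 1)
      exact ⟨this, this.not⟩
    | div =>
      have := Fml.ignoresCll_eq (Expr.eval_trans_update (.bin .div a b)) (hc 1)
      exact ⟨this, this.not⟩

theorem HP.IgnoresCll.assign {x : DVar} {a : Term DVar} (hx : x ≠ .cll)
    (ha : ∀ σ c, a.eval (Function.update σ .cll c) = a.eval σ) :
    (HP.assign x a).IgnoresCll := by
  rintro σ σ' rfl
  refine ⟨Function.update_of_ne hx.symm _ _, fun c => ?_⟩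
  simp only [HP.Run, ha]
  exact Function.update_comm hx _ _ _

theorem HP.IgnoresCll.havoc {x : DVar} (hx : x ≠ .cll) : (HP.havoc x).IgnoresCll := by
  rintro σ σ' ⟨r, rfl⟩
  exact ⟨Function.update_of_ne hx.symm _ _, fun c => ⟨r, Function.update_comm hx _ _ _⟩⟩

theorem HP.IgnoresCll.test {φ : Fml} (h : φ.IgnoresCll) : (HP.test φ).IgnoresCll := by
  rintro σ σ' ⟨rfl, hs⟩
  exact ⟨rfl, fun c => ⟨rfl, (h _ c).2 hs⟩⟩

theorem HP.IgnoresCll.seq {α β : HP} (h₁ : α.IgnoresCll) (h₂ : β.IgnoresCll) :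
    (HP.seq α β).IgnoresCll := by
  rintro σ σ' ⟨ρ, hr₁, hr₂⟩
  exact ⟨(h₂ _ _ hr₂).1.trans (h₁ _ _ hr₁).1,
    fun c => ⟨_, (h₁ _ _ hr₁).2 c, (h₂ _ _ hr₂).2 c⟩⟩

theorem HP.IgnoresCll.seqs {l : List HP} (h : ∀ α ∈ l, α.IgnoresCll) :
    (HP.seqs l).IgnoresCll := by
  induction l with
  | nil => exact .test Fml.ignoresCll_tt
  | cons a l ih =>
    exact .seq (h a List.mem_cons_self) (ih fun α hα => h α (List.mem_cons_of_mem _ hα))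

theorem Fml.IgnoresCll.inst {φ : Fml} (hφ : φ.IgnoresCll) {xs : List DVar} {es : List Expr}
    (hx : ∀ x ∈ xs, x ≠ .cll) : (φ.inst xs (es.map Expr.trans)).IgnoresCll := by
  refine .box (.seqs fun α hα => ?_) (.box (.seqs fun α hα => ?_) hφ)
  · obtain ⟨⟨a, i⟩, hp, rfl⟩ := List.mem_map.1 hα
    have ha := List.fst_mem_of_mem_zipIdx hp
    obtain ⟨e, -, rfl⟩ := List.mem_map.1 ha
    exact .assign DVar.noConfusion (Expr.eval_trans_update e)
  · obtain ⟨⟨x, i⟩, hp, rfl⟩ := List.mem_map.1 hα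
    exact .assign (hx _ (List.fst_mem_of_mem_zipIdx hp)) fun σ c =>
      Function.update_of_ne DVar.noConfusion _ _

theorem ClassDecl.cll_notMem_fieldVars (D : ClassDecl) : DVar.cll ∉ D.fieldVars := by
  rintro ⟨f, -, hf⟩
  cases hf

theorem Program.WellFormed.preOf_ignoresCll {P : Program} (hP : P.WellFormed) (C : Option Name)
    (m : Name) (args : List Expr) : (P.preOf C m args).IgnoresCll := by
  unfold Program.preOf
  split
  · rename_i d hd
    obtain ⟨D, hD, hd⟩ := Option.bind_eq_some_iff.1 hd
    obtain ⟨C', -, hC'⟩ := Option.bind_eq_some_iff.1 hD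
    have hpre := hP.pre_scope D (Program.mem_of_findClass hC').1 d
      (ClassDecl.mem_of_findMethod hd).1
    refine (hpre.ignoresCll ?_).inst fun x hx => ?_
    · rintro ⟨v, -, hv⟩
      cases hv
    · obtain ⟨v, -, rfl⟩ := List.mem_map.1 hx
      exact DVar.noConfusion
  · exact Fml.ignoresCll_tt

theorem Program.WellFormed.creationOf_ignoresCll {P : Program} (hP : P.WellFormed) (C : Name)
    (args : List Expr) : (P.creationOf C args).IgnoresCll := by
  unfold Program.creationOf
  split
  · rename_i D hD
    refine ((hP.creation_scope D (Program.mem_of_findClass hD).1).ignoresCll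
      D.cll_notMem_fieldVars).inst fun x hx => ?_
    obtain ⟨v, -, rfl⟩ := List.mem_map.1 hx
    exact DVar.noConfusion
  · exact Fml.ignoresCll_tt

theorem Program.WellFormed.inv_ignoresCll {P : Program} (hP : P.WellFormed) {D : ClassDecl}
    (hD : D ∈ P.classes) : D.inv.IgnoresCll :=
  (hP.inv_scope D hD).ignoresCll D.cll_notMem_fieldVars

theorem ClassDecl.mem_evolve_ode {D : ClassDecl} {p : DVar × DTerm DVar}
    (hp : p ∈ D.ode ++ [(.t, .term (.const 1))]) :
    p.1 ≠ .cll ∧ ∃ d : DTerm Ident, p.2 = d.map .prog := by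
  rcases List.mem_append.1 hp with hp | hp
  · obtain ⟨f, -, rfl⟩ := List.mem_map.1 hp
    exact ⟨DVar.noConfusion, f.rhs, rfl⟩
  · obtain rfl := List.mem_singleton.1 hp
    exact ⟨DVar.noConfusion, .term (.const 1), rfl⟩

/-- No equation governs `cll`, so it is constant along a solution; overwriting it with another
constant gives a solution again, as right-hand sides and domain do not read it. -/
theorem ClassDecl.evolve_ignoresCll (D : ClassDecl) {ψ : Fml} (hψ : ψ.IgnoresCll) :
    (D.evolve ψ).IgnoresCll := by
  rintro σ σ' ⟨T, γ, hT, rfl, rfl, h⟩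
  refine ⟨(h T ⟨hT, le_rfl⟩).2.2 .cll fun p hp => (ClassDecl.mem_evolve_ode hp).1, fun c =>
    ⟨T, fun u => Function.update (γ u) .cll c, hT, rfl, rfl, fun s hs => ?_⟩⟩
  obtain ⟨h₁, h₂, h₃⟩ := h s hs
  refine ⟨(hψ _ _).2 h₁, fun p hp => ?_, fun x hx => ?_⟩
  · obtain ⟨r, hr, hd⟩ := h₂ p hp
    obtain ⟨hne, d, hpd⟩ := ClassDecl.mem_evolve_ode hp
    refine ⟨r, ?_, ?_⟩
    · rw [hpd] at hr ⊢
      exact (DTerm.hasValue_update_of_map (fun _ => DVar.noConfusion) d γ _ s c r).2 hr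
    · simpa only [Function.update_of_ne hne] using hd
  · rcases eq_or_ne x .cll with rfl | hne
    · simp
    · simpa only [Function.update_of_ne hne] using h₃ x hx

theorem ClassDecl.pr_ignoresCll {D : ClassDecl} (hD : D.inv.IgnoresCll) {ψ : Fml}
    (hψ : ψ.IgnoresCll) : (D.pr ψ).IgnoresCll :=
  hD.and (.box (.seq (.assign DVar.noConfusion fun _ _ => rfl) (D.evolve_ignoresCll hψ)) hD)

/-- `pr` is antitone in the region: a trajectory inside the smaller domain also stays inside the
larger one. -/
theorem ClassDecl.pr_mono {D : ClassDecl} {φ ψ : Fml} (h : ∀ σ, φ.Sat σ → ψ.Sat σ) {σ : State}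
    (hψ : (D.pr ψ).Sat σ) : (D.pr φ).Sat σ := by
  refine ⟨hψ.1, ?_⟩
  rintro σ' ⟨ρ, hρ, T, γ, hT, h0, h1, hγ⟩
  exact hψ.2 σ' ⟨ρ, hρ, T, γ, hT, h0, h1, fun s hs => ⟨h _ (hγ s hs).1, (hγ s hs).2⟩⟩

theorem MethodDecl.trigger_weakNeg_ignoresCll (d : MethodDecl) :
    d.trigger.weakNeg.IgnoresCll := by
  unfold MethodDecl.trigger
  split
  · rename_i g hg
    cases g with
    | fut e => exact Fml.ignoresCll_tt
    | duration e =>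
      exact Fml.ignoresCll_le (fun σ c => Function.update_of_ne DVar.noConfusion _ _)
        (Expr.eval_trans_update e)
    | diff e => exact (Expr.fml_ignoresCll e).2
  · exact Fml.ignoresCll_tt

theorem Program.ctrlGenerator_ignoresCll (P : Program) (x : Point) :
    (P.ctrlGenerator x).IgnoresCll := by
  refine .conj fun φ hφ => ?_
  obtain ⟨d, -, rfl⟩ := List.mem_map.1 hφ
  exact d.trigger_weakNeg_ignoresCll

/-! ## Simulation up to the failure flag -/

/-- Every run of `α` is a run of `β`, except that `β` may record a failure that `α` does not
record. -/
def HP.Sim (α β : HP) : Prop :=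
  ∀ σ σ' : State, α.Run σ σ' → ∀ c : ℝ, (c = 0 → σ .cll = 0) →
    ∃ c' : ℝ, (c' = 0 → σ' .cll = 0) ∧
      β.Run (Function.update σ .cll c) (Function.update σ' .cll c')

theorem HP.IgnoresCll.sim {α : HP} (h : α.IgnoresCll) : α.Sim α := fun σ σ' hr c hc =>
  ⟨c, fun h0 => (h σ σ' hr).1.trans (hc h0), (h σ σ' hr).2 c⟩

theorem HP.Sim.seq {α α' β β' : HP} (h₁ : α.Sim α') (h₂ : β.Sim β') :
    (HP.seq α β).Sim (HP.seq α' β') := by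
  rintro σ σ' ⟨ρ, hr₁, hr₂⟩ c hc
  obtain ⟨c₁, hc₁, hr₁⟩ := h₁ _ _ hr₁ c hc
  obtain ⟨c₂, hc₂, hr₂⟩ := h₂ _ _ hr₂ c₁ hc₁
  exact ⟨c₂, hc₂, _, hr₁, hr₂⟩

theorem HP.Sim.choice {α α' β β' : HP} (h₁ : α.Sim α') (h₂ : β.Sim β') :
    (HP.choice α β).Sim (HP.choice α' β') := by
  rintro σ σ' (hr | hr) c hc
  · obtain ⟨c', hc', hr⟩ := h₁ _ _ hr c hc
    exact ⟨c', hc', Or.inl hr⟩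
  · obtain ⟨c', hc', hr⟩ := h₂ _ _ hr c hc
    exact ⟨c', hc', Or.inr hr⟩

theorem HP.Sim.star {α α' : HP} (h : α.Sim α') : (HP.star α).Sim (HP.star α') := by
  intro σ σ' hr c hc
  simp only [HP.Run] at hr ⊢
  induction hr with
  | refl => exact ⟨c, hc, .refl⟩
  | tail _ hstep ih =>
    obtain ⟨c₁, hc₁, hr₁⟩ := ih
    obtain ⟨c₂, hc₂, hr₂⟩ := h _ _ hstep c₁ hc₁
    exact ⟨c₂, hc₂, hr₁.tail hr₂⟩

theorem HP.Sim.fail : HP.fail.Sim HP.fail := by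
  rintro σ σ' rfl c hc
  -- After a failure the flag is `1`, and the condition linking the two flags holds vacuously.
  refine ⟨1, fun h => absurd h one_ne_zero, ?_⟩
  simp [HP.fail, HP.Run, Term.eval]

theorem HP.Sim.check {φ : Fml} (h : φ.IgnoresCll) : (HP.check φ).Sim (HP.check φ) :=
  (HP.IgnoresCll.test h).sim.choice ((HP.IgnoresCll.test h.not).sim.seq .fail)

/-- A safety check for a weaker condition is simulated by a check for a stronger one. -/
theorem HP.Sim.safetyCheck {φ ψ : Fml} {α β : HP} (hψ : ψ.IgnoresCll)
    (himp : ∀ σ, ψ.Sat σ → φ.Sat σ) (hα : α.IgnoresCll) (hβ : β.IgnoresCll)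
    (hαβ : ∀ σ σ', α.Run σ σ' → β.Run σ σ') :
    (HP.choice (.seq (.test φ) α) (.seq (.seq (.test (.not φ)) .fail) β)).Sim
      (HP.choice (.seq (.test ψ) α) (.seq (.seq (.test (.not ψ)) .fail) β)) := by
  -- Where the stronger condition `ψ` fails, any run of `β` is available behind the failing branch,
  -- with final flag `1`.
  have fails : ∀ σ σ' c, ¬ ψ.Sat σ → β.Run σ σ' →
      (HP.seq (.seq (.test (.not ψ)) .fail) β).Run (Function.update σ .cll c)
        (Function.update σ' .cll 1) := fun σ σ' c hn hr =>
    ⟨_, ⟨_, ⟨rfl, fun h => hn ((hψ _ _).1 h)⟩, rfl⟩, by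
      rw [Function.update_idem]; exact (hβ _ _ hr).2 1⟩
  rintro σ σ' (⟨ρ, ⟨rfl, -⟩, hr⟩ | ⟨ρ, ⟨ρ', ⟨rfl, hn⟩, rfl⟩, hr⟩) c hc
  -- If the weak check passes and the strong one does not, the simulating run crosses to the failing
  -- branch; `hαβ` says that this branch allows at least the same state changes.
  · by_cases hs : ψ.Sat ρ
    · obtain ⟨c', hc', hr⟩ := hα.sim _ _ hr c hc
      exact ⟨c', hc', Or.inl ⟨_, ⟨rfl, (hψ _ _).2 hs⟩, hr⟩⟩
    · exact ⟨1, fun h => absurd h one_ne_zero, Or.inr (fails _ _ c hs (hαβ _ _ hr))⟩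
  · refine ⟨1, fun h => absurd h one_ne_zero, Or.inr ?_⟩
    -- The given run of `β` starts after `fail`; the original flag is put back so that `fails`
    -- applies.
    have hr' := (hβ _ _ hr).2 (ρ' .cll)
    rw [Function.update_idem, Function.update_eq_self] at hr'
    have := fails _ _ c (fun h => hn (himp _ h)) hr'
    rwa [Function.update_idem] at this

theorem havocTarget_ignoresCll (v : Option Ident) : (havocTarget v).IgnoresCll := by
  cases v with
  | none => exact .test Fml.ignoresCll_tt
  | some v => exact .havoc DVar.noConfusion

theorem HP.seqs_havoc_ignoresCll (l : List Name) :
    (HP.seqs (l.map fun f => .havoc (.prog (.field f)))).IgnoresCll := by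
  refine .seqs fun α hα => ?_
  obtain ⟨f, -, rfl⟩ := List.mem_map.1 hα
  exact .havoc DVar.noConfusion

theorem Guard.fml_ignoresCll (g : Guard) : g.fml.IgnoresCll := by
  cases g with
  | diff e => exact (Expr.fml_ignoresCll e).1
  | _ => exact Fml.ignoresCll_tt

theorem Fml.IgnoresCll.region {ψ : Fml} (h : ψ.IgnoresCll) (g : Guard) :
    (g.region ψ).IgnoresCll := by
  cases g with
  | diff e => exact h.and (Expr.fml_ignoresCll e).2
  | _ => exact h

theorem Guard.region_mono {φ ψ : Fml} (h : ∀ σ, φ.Sat σ → ψ.Sat σ) (g : Guard) (σ : State)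
    (hs : (g.region φ).Sat σ) : (g.region ψ).Sat σ := by
  cases g with
  | diff e => exact ⟨h _ hs.1, hs.2⟩
  | _ => exact h _ hs

/-- The translation with smaller regions is simulated by the translation with larger regions. -/
theorem Stmt.sim_trans {P : Program} (hP : P.WellFormed) {D : ClassDecl} (hD : D ∈ P.classes)
    {Φ Ψ : Generator} (hΨ : ∀ p, (Ψ (.await D.name p)).IgnoresCll)
    (hmono : ∀ p σ, (Φ (.await D.name p)).Sat σ → (Ψ (.await D.name p)).Sat σ) (s : Stmt) :
    (s.trans P Φ D).Sim (s.trans P Ψ D) := by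
  have hinv := hP.inv_ignoresCll hD
  induction s with
  | skip => exact (HP.IgnoresCll.test Fml.ignoresCll_tt).sim
  | loop e s ih =>
    have he := (Expr.fml_ignoresCll e).1
    exact .seq (.star (.seq (HP.IgnoresCll.test he).sim ih)) (HP.IgnoresCll.test he.not).sim
  | ite e s₁ s₂ ih₁ ih₂ =>
    have he := (Expr.fml_ignoresCll e).1
    exact .choice (.seq (HP.IgnoresCll.test he).sim ih₁)
      (.seq (HP.IgnoresCll.test he.not).sim ih₂)
  | seq s₁ s₂ ih₁ ih₂ => exact .seq ih₁ ih₂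
  | await p g =>
    refine HP.Sim.safetyCheck (ClassDecl.pr_ignoresCll hinv ((hΨ p).region g))
      (fun σ => ClassDecl.pr_mono (Guard.region_mono (hmono p) g))
      (.seq (HP.seqs_havoc_ignoresCll _) (.test (g.fml_ignoresCll.and hinv)))
      (.seq (HP.seqs_havoc_ignoresCll _) (.test g.fml_ignoresCll)) ?_
    rintro σ σ' ⟨ρ, h₁, h₂, h₃⟩
    exact ⟨ρ, h₁, h₂, h₃.1⟩
  | assign v r =>
    cases r with
    | expr e =>
      cases v with
      | none => exact (HP.IgnoresCll.test Fml.ignoresCll_tt).sim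
      | some v =>
        exact (HP.IgnoresCll.assign DVar.noConfusion (Expr.eval_trans_update e)).sim
    | new C args =>
      simp only [Stmt.trans]
      exact .seq (.check (hP.creationOf_ignoresCll C args)) (havocTarget_ignoresCll v).sim
    | get e =>
      have hv := havocTarget_ignoresCll v
      simp only [Stmt.trans]
      refine HP.Sim.safetyCheck (ClassDecl.pr_ignoresCll hinv Fml.ignoresCll_tt) (fun σ h => h)
        (.seq (HP.seqs_havoc_ignoresCll _) (.seq (.test hinv) hv))
        (.seq (HP.seqs_havoc_ignoresCll _) hv) ?_
      rintro σ σ' ⟨ρ, h₁, ρ', ⟨rfl, -⟩, h₂⟩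
      exact ⟨_, h₁, h₂⟩
    | call o m args =>
      simp only [Stmt.trans]
      exact .seq (.check (hP.preOf_ignoresCll _ m args)) (havocTarget_ignoresCll v).sim
  | duration e =>
    have ht : ∀ σ c, (Term.var DVar.t).eval (Function.update σ .cll c) =
        (Term.var DVar.t).eval σ := fun _ _ => Function.update_of_ne DVar.noConfusion _ _
    have h0 : (HP.assign .t (.const 0)).IgnoresCll :=
      .assign DVar.noConfusion fun _ _ => rfl
    have hle := Fml.ignoresCll_le ht (Expr.eval_trans_update e)
    exact .seq h0.sim (.seq (.check (ClassDecl.pr_ignoresCll hinv hle)) (.seq h0.sim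
      (.seq (D.evolve_ignoresCll hle).sim
        (HP.IgnoresCll.test (Fml.ignoresCll_le (Expr.eval_trans_update e) ht)).sim)))


/-- Simulation preserves postconditions that include the absence of failures. -/
theorem Fml.box_of_sim {α β : HP} (h : α.Sim β) {φ ψ : Fml} (himp : ∀ σ, ψ.Sat σ → φ.Sat σ)
    {σ : State} (hσ : Fml.noFail.Sat σ) (hβ : (Fml.box β (.and .noFail ψ)).Sat σ) :
    (Fml.box α (.and .noFail φ)).Sat σ := by
  intro σ' hr
  obtain ⟨c', hc', hr'⟩ := h _ _ hr 0 fun _ => hσ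
  have h0 : Function.update σ .cll 0 = σ := by
    rw [← show σ .cll = 0 from hσ, Function.update_eq_self]
  rw [h0] at hr'
  obtain ⟨hn, hs⟩ := hβ _ hr'
  -- The postcondition excludes failures in the simulating run, so both flags are `0` and the two
  -- final states coincide.
  have hc0 : c' = 0 := by simpa [Fml.noFail, Fml.Sat, Term.eval] using hn
  have hσ' := hc' hc0
  rw [hc0, ← hσ', Function.update_eq_self] at hs
  exact ⟨hσ', himp _ hs⟩

-- Validity of obligations is antitone in the regions

theorem Program.initObligation_mono {P : Program} (hP : P.WellFormed) {D : ClassDecl}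
    (hD : D ∈ P.classes) {Φ Ψ : Generator} (hΨ : ∀ x, (Ψ x).IgnoresCll)
    (hmono : ∀ x : Point, x.cls = D.name → ∀ σ, (Φ x).Sat σ → (Ψ x).Sat σ)
    (h : (P.initObligation Ψ D).Valid) : (P.initObligation Φ D).Valid := by
  intro σ
  by_cases hσ : (Fml.and D.creation .noFail).Sat σ
  · exact Or.inr (Fml.box_of_sim (Stmt.sim_trans hP hD (fun _ => hΨ _) (fun p => hmono _ rfl) _)
      (fun σ => ClassDecl.pr_mono (hmono _ rfl)) hσ.2 ((h σ).resolve_left (not_not_intro hσ)))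
  · exact Or.inl hσ

theorem Program.methodObligation_mono {P : Program} (hP : P.WellFormed) {D : ClassDecl}
    (hD : D ∈ P.classes) {Φ Ψ : Generator} (hΨ : ∀ x, (Ψ x).IgnoresCll)
    (hmono : ∀ x : Point, x.cls = D.name → ∀ σ, (Φ x).Sat σ → (Ψ x).Sat σ) {d : MethodDecl}
    (h : (P.methodObligation Ψ D d).Valid) : (P.methodObligation Φ D d).Valid := by
  intro σ
  by_cases hσ : (Fml.and D.inv (.and d.pre .noFail)).Sat σ
  · exact Or.inr (Fml.box_of_sim (.seq (Stmt.sim_trans hP hD (fun _ => hΨ _)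
      (fun p => hmono _ rfl) _) (HP.IgnoresCll.assign DVar.noConfusion
        (Expr.eval_trans_update d.ret)).sim)
      (φ := .and d.post (D.pr (Φ (.method D.name d.name))))
      (ψ := .and d.post (D.pr (Ψ (.method D.name d.name))))
      (fun σ hs => ⟨hs.1, ClassDecl.pr_mono (hmono _ rfl) hs.2⟩) hσ.2.2
      ((h σ).resolve_left (not_not_intro hσ)))
  · exact Or.inl hσ

theorem Program.obligation_mono {P : Program} (hP : P.WellFormed) {C : Name}
    {Φ Ψ : Generator} (hΨ : ∀ x, (Ψ x).IgnoresCll)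
    (hmono : ∀ x : Point, x.cls = C → ∀ σ, (Φ x).Sat σ → (Ψ x).Sat σ) {b : Block}
    (h : (P.obligation Ψ C b).Valid) : (P.obligation Φ C b).Valid := by
  cases hC : P.findClass C with
  | none => simp only [Program.obligation, hC] at h ⊢; exact h
  | some D =>
    obtain ⟨hD, rfl⟩ := Program.mem_of_findClass hC
    cases b with
    | init =>
      simp only [Program.obligation, hC] at h ⊢
      exact Program.initObligation_mono hP hD hΨ hmono h
    | method m =>
      simp only [Program.obligation, hC] at h ⊢
      cases hm : D.findMethod m with
      | none => simp only [hm] at h ⊢; exact h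
      | some d =>
        simp only [hm] at h ⊢
        exact Program.methodObligation_mono hP hD hΨ hmono h

/-- Removing a method that is not a controller can only shrink the controlled regions. -/
theorem Program.sat_ctrlGenerator_of_remove {P : Program} {C m : Name} {D : ClassDecl}
    (hD : P.findClass C = some D) (hm : ¬ P.IsController C m) {x : Point} (hx : x.cls = C)
    {σ : State} (h : ((P.remove C m).ctrlGenerator x).Sat σ) : (P.ctrlGenerator x).Sat σ := by
  simp only [Program.ctrlGenerator, hx, Fml.sat_conj, List.mem_map] at h ⊢
  rintro φ ⟨d, hd, rfl⟩
  obtain ⟨hd, hc⟩ := (Program.mem_controllers hD).1 hd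
  have hne : d.name ≠ m := fun he => hm (he ▸ hc)
  refine h _ ⟨d.remove (some D.name) C m, ?_, by rw [MethodDecl.trigger_remove]⟩
  rw [Program.controllers_remove hD]
  exact List.mem_map_of_mem (List.mem_filter.2 ⟨hd, by simp [hc.remove hne, hne]⟩)

/-- New controllers are allowed here, so obligations of non-calling blocks may change as formulas;
their validity is inherited because the regions only shrink. -/
theorem verified_remove_iff {P : Program} (hP : P.WellFormed) {C m : Name} (hC : P.HasClass C)
    (hver : P.Verified C) (hm : ¬ P.IsController C m) :
    (P.remove C m).Verified C ↔ ∀ b, (P.remove C m).HasBlock C b → P.BlockCalls C b m →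
      ((P.remove C m).ctrlObligation C b).Valid := by
  refine ⟨fun h b hb _ => h b hb, fun h b hb => ?_⟩
  by_cases hc : P.BlockCalls C b m
  · exact h b hb hc
  · obtain ⟨D, hD, rfl⟩ := hC
    rw [Program.ctrlObligation, Program.obligation_remove hP _ hb hc]
    exact Program.obligation_mono hP P.ctrlGenerator_ignoresCll
      (fun x hx σ => Program.sat_ctrlGenerator_of_remove (hP.findClass hD) hm hx)
      (hver b hb.of_remove)


/-! ## A tank that is safe only as long as its controller runs -/

namespace Tank

/-- The guard `diff (level ≥ 1)`. -/
def guard : Guard := .diff (.bin .ge (.var (.field 0)) (.const 1))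

/-- The controller empties the tank whenever the level reaches `1`. -/
def controller : MethodDecl where
  name := 0
  params := []
  body := .seq (.await 0 guard) (.seq (.assign (some (.field 0)) (.expr (.const 0)))
    (.assign none (.call .this 0 [])))
  ret := .const 0
  pre := .tt
  post := .tt

/-- A method that waits until the level has reached `1`. -/
def observer (i : ℕ) : MethodDecl where
  name := i + 1
  params := []
  body := .await (i + 1) guard
  ret := .const 0
  pre := .tt
  post := .tt

/-- The level grows with slope `1` and must not exceed `1`. -/
def cls (n : ℕ) : ClassDecl where
  name := 0
  params := []
  fields := []
  phys := [⟨0, .const 0, .term (.const 1)⟩]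
  init := .assign none (.call .this 0 [])
  methods := controller :: (List.range n).map observer
  creation := .tt
  inv := .le (.var (.prog (.field 0))) (.const 1)

def program (n : ℕ) : Program where
  classes := [cls n]
  main := .assign none (.new 0 [])

theorem mem_methods {n : ℕ} {d : MethodDecl} :
    d ∈ (cls n).methods ↔ d = controller ∨ ∃ i < n, d = observer i := by
  simp [cls, eq_comm]

theorem wellFormed (n : ℕ) : (program n).WellFormed where
  classes_nodup := by simp [program]
  methods_nodup := by
    intro D hD
    obtain rfl := List.mem_singleton.1 hD
    simp only [cls, List.map_cons, List.map_map, List.nodup_cons, List.mem_map]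
    refine ⟨?_, List.Nodup.map (fun i j h => ?_) List.nodup_range⟩
    · rintro ⟨i, -, h⟩
      exact absurd h (Nat.succ_ne_zero i)
    · exact Nat.succ_injective h
  main_calls := fun C m h => h.elim
  init_calls := by
    intro D hD C m h
    obtain rfl := List.mem_singleton.1 hD
    obtain ⟨h, rfl⟩ := h
    obtain rfl := Option.some.inj h
    exact ⟨cls n, List.mem_singleton_self _, rfl, controller, mem_methods.2 (Or.inl rfl), rfl⟩
  body_calls := by
    intro D hD d hd C m h
    obtain rfl := List.mem_singleton.1 hD
    rcases mem_methods.1 hd with rfl | ⟨i, -, rfl⟩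
    · rcases h with h | h | ⟨h, rfl⟩
      · exact h.elim
      · exact h.elim
      · obtain rfl := Option.some.inj h
        exact ⟨cls n, List.mem_singleton_self _, rfl, controller, mem_methods.2 (Or.inl rfl), rfl⟩
    · exact h.elim
  creation_scope := by
    intro D hD σ τ _
    obtain rfl := List.mem_singleton.1 hD
    exact Iff.rfl
  inv_scope := by
    intro D hD σ τ h
    obtain rfl := List.mem_singleton.1 hD
    have := h (.prog (.field 0)) ⟨0, by simp [cls, ClassDecl.fieldNames, ClassDecl.physNames], rfl⟩
    simp only [cls, Fml.Sat, Term.eval, this]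
  pre_scope := by
    intro D hD d hd σ τ _
    obtain rfl := List.mem_singleton.1 hD
    rcases mem_methods.1 hd with rfl | ⟨i, -, rfl⟩ <;> exact Iff.rfl
  post_scope := by
    intro D hD d hd σ τ _
    obtain rfl := List.mem_singleton.1 hD
    rcases mem_methods.1 hd with rfl | ⟨i, -, rfl⟩ <;> exact Iff.rfl

theorem suspensionLeading (n : ℕ) : (program n).SuspensionLeading := by
  intro D hD d hd
  obtain rfl := List.mem_singleton.1 hD
  rcases mem_methods.1 hd with rfl | ⟨i, -, rfl⟩ <;> exact ⟨_, rfl⟩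

theorem isController (n : ℕ) : (program n).IsController 0 0 := by
  refine ⟨⟨cls n, List.mem_singleton_self _, rfl, rfl, controller, mem_methods.2 (Or.inl rfl), rfl,
    0, guard, [.assign (some (.field 0)) (.expr (.const 0))], none, [], rfl, ?_⟩, fun h => h, ?_⟩
  · intro s hs
    obtain rfl := List.mem_singleton.1 hs
    exact ⟨trivial, fun h => h⟩
  · intro D hD
    obtain rfl := List.mem_singleton.1 hD
    refine ⟨fun _ => rfl, fun d hd h => ⟨rfl, ?_⟩⟩
    rcases mem_methods.1 hd with rfl | ⟨i, -, rfl⟩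
    · rfl
    · exact h.elim

theorem findClass (n : ℕ) : (program n).findClass 0 = some (cls n) :=
  (wellFormed n).findClass (D := cls n) (List.mem_singleton_self _)

/-- The weak negation of the trigger `level ≥ 1` is `level ≤ 1`, which is precisely the invariant.
-/
theorem level_le_of_ctrlGenerator {n : ℕ} {x : Point} (hx : x.cls = 0) {σ : State}
    (h : ((program n).ctrlGenerator x).Sat σ) : σ (.prog (.field 0)) ≤ 1 := by
  simp only [Program.ctrlGenerator, hx, Fml.sat_conj, List.mem_map] at h
  exact h _ ⟨controller, (Program.mem_controllers (findClass n)).2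
    ⟨mem_methods.2 (Or.inl rfl), isController n⟩, rfl⟩

/-- The evolution domain still holds at the end of the evolution, so the dynamics play no role. -/
theorem pr_of_region {n : ℕ} {ψ : Fml} (hψ : ∀ ρ, ψ.Sat ρ → ρ (.prog (.field 0)) ≤ 1)
    {σ : State} (hσ : σ (.prog (.field 0)) ≤ 1) : ((cls n).pr ψ).Sat σ := by
  refine ⟨hσ, ?_⟩
  rintro σ' ⟨ρ, -, T, γ, hT, -, rfl, h⟩
  exact hψ _ (h T ⟨hT, le_rfl⟩).1

/-- Without a region, the level exceeds `1` sooner or later. -/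
theorem not_pr_of_forall {D : ClassDecl} (hphys : D.phys = [⟨0, .const 0, .term (.const 1)⟩])
    (hinv : D.inv = .le (.var (.prog (.field 0))) (.const 1)) {ψ : Fml} (hψ : ψ.Valid)
    (σ : State) : ¬ (D.pr ψ).Sat σ := by
  rintro ⟨h₁, h₂⟩
  rw [hinv] at h₁ h₂
  have h₁ : σ (.prog (.field 0)) ≤ 1 := h₁
  set ρ : State := Function.update σ .t 0 with hρ
  have hx : ρ (.prog (.field 0)) = σ (.prog (.field 0)) :=
    Function.update_of_ne DVar.noConfusion _ _
  have ht : ρ .t = 0 := Function.update_self _ _ _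
  set γ : ℝ → State := fun s =>
    Function.update (Function.update ρ (.prog (.field 0)) (ρ (.prog (.field 0)) + s)) .t s with hγ
  have hγx : ∀ s, γ s (.prog (.field 0)) = ρ (.prog (.field 0)) + s := fun s => by simp [hγ]
  have hγt : ∀ s, γ s .t = s := fun s => by simp [hγ]
  have hγ0 : γ 0 = ρ := by
    simp only [hγ, add_zero, Function.update_eq_self]
    rw [← ht, Function.update_eq_self]
  -- The duration is nonnegative because the level starts at most at `1`, and it brings the level to
  -- exactly `2`.
  have hrun : (D.evolve ψ).Run ρ (γ (2 - ρ (.prog (.field 0)))) := by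
    refine ⟨_, γ, by rw [hx]; linarith, hγ0, rfl, fun s _ => ⟨hψ _, fun p hp => ?_, fun x hxx => ?_⟩⟩
    · have hp' : p = (.prog (.field 0), .term (.const 1)) ∨ p = (.t, .term (.const 1)) := by
        simpa [ClassDecl.ode, hphys, DTerm.map, Term.map] using hp
      rcases hp' with rfl | rfl
      · refine ⟨1, rfl, ?_⟩
        simp only [hγx]
        exact ((hasDerivAt_id s).const_add _).hasDerivWithinAt
      · refine ⟨1, rfl, ?_⟩
        simp only [hγt]
        exact (hasDerivAt_id s).hasDerivWithinAt
    · have hn₁ : x ≠ .prog (.field 0) := fun he =>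
        hxx (.prog (.field 0), .term (.const 1))
          (by simp [ClassDecl.ode, hphys, DTerm.map, Term.map]) he.symm
      have hn₂ : x ≠ .t := fun he => hxx (.t, .term (.const 1)) (by simp) he.symm
      simp only [hγ, Function.update_of_ne hn₁, Function.update_of_ne hn₂]
  have := h₂ _ ⟨ρ, rfl, hrun⟩
  simp only [Fml.Sat, Term.eval, hγx] at this
  linarith

-- The tank with its controller

theorem verified (n : ℕ) : (program n).Verified 0 := by
  have hpre : ∀ ρ, ((program n).preOf (some 0) 0 []).Sat ρ := by
    intro ρ σ' _ σ'' _
    exact (rfl : (0 : ℝ) = 0)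
  have hcall : ∀ ρ ρ', ((Stmt.assign none (.call .this 0 [])).trans (program n)
      (program n).ctrlGenerator (cls n)).Run ρ ρ' → ρ' = ρ := by
    rintro ρ ρ' ⟨ρ₁, ⟨rfl, -⟩ | ⟨ρ₂, ⟨rfl, hn⟩, -⟩, rfl, -⟩
    · rfl
    · exact absurd (hpre _) hn
  -- The region contains the invariant, so the safety check always passes and the failing branch is
  -- dead; the passing branch ends with a test of the invariant.
  have hawait : ∀ p ρ ρ', ρ (.prog (.field 0)) ≤ 1 → ((Stmt.await p guard).trans (program n)
      (program n).ctrlGenerator (cls n)).Run ρ ρ' →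
      ρ' .cll = ρ .cll ∧ ρ' (.prog (.field 0)) ≤ 1 := by
    rintro p ρ ρ' hρ (⟨ρ₁, ⟨rfl, -⟩, ρ₂, ⟨ρ₃, ⟨r, rfl⟩, rfl, -⟩, rfl, -, hinv⟩ |
      ⟨ρ₁, ⟨ρ₂, ⟨rfl, hn⟩, -⟩, -⟩)
    · exact ⟨Function.update_of_ne DVar.noConfusion _ _, hinv⟩
    · exact absurd (pr_of_region (ψ := guard.region ((program n).ctrlGenerator (.await 0 p)))
        (fun ρ h => level_le_of_ctrlGenerator (x := .await 0 p) rfl h.1) hρ) hn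
  intro b hb
  cases b with
  | init =>
    rw [Program.ctrlObligation_init (findClass n)]
    intro σ
    by_cases h : (Fml.and (cls n).creation .noFail).Sat σ
    · right
      rintro σ' ⟨ρ, rfl, hr⟩
      obtain rfl := hcall _ _ hr
      exact ⟨(Function.update_of_ne DVar.noConfusion _ _).trans h.2,
        pr_of_region (fun ρ h => level_le_of_ctrlGenerator rfl h)
          (by simp [Expr.trans, Term.map, Term.eval])⟩
    · exact Or.inl h
  | method k =>
    obtain ⟨D, hD, -, d, hd, rfl⟩ := hb
    obtain rfl := List.mem_singleton.1 hD
    rw [Program.ctrlObligation_method (findClass n)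
      ((wellFormed n).findMethod (D := cls n) (List.mem_singleton_self _) hd)]
    intro σ
    by_cases h : (Fml.and (cls n).inv (.and d.pre .noFail)).Sat σ
    · right
      obtain ⟨hinv, -, hcll⟩ := h
      rcases mem_methods.1 hd with rfl | ⟨i, -, rfl⟩
      · rintro σ' ⟨ρ, ⟨ρ₁, hr₁, ρ₂, rfl, hr₂⟩, rfl⟩
        obtain rfl := hcall _ _ hr₂
        obtain ⟨h₁, -⟩ := hawait _ _ _ hinv hr₁
        refine ⟨?_, rfl, pr_of_region (fun ρ h => level_le_of_ctrlGenerator rfl h) ?_⟩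
        · exact h₁.trans hcll
        · simp [Expr.trans, Term.map, Term.eval]
      · rintro σ' ⟨ρ, hr, rfl⟩
        obtain ⟨h₁, h₂⟩ := hawait _ _ _ hinv hr
        exact ⟨h₁.trans hcll, rfl, pr_of_region (fun ρ h => level_le_of_ctrlGenerator rfl h) h₂⟩
    · exact Or.inl h

-- The tank after the removal of its controller

/-- The initial block consisted of the removed call alone; as `skip` it calls nothing, and a
controller must be called there. -/
theorem not_isController_remove (n : ℕ) (k : Name) :
    ¬ ((program n).remove 0 0).IsController 0 k := by
  rintro ⟨⟨D', hD', -, hi, -⟩, -⟩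
  obtain ⟨D, hD, rfl⟩ := List.mem_map.1 hD'
  obtain rfl := List.mem_singleton.1 hD
  exact hi

theorem noNewController (n : ℕ) : NoNewController (program n) ((program n).remove 0 0) 0 :=
  fun k h => absurd h (not_isController_remove n k)

theorem hasMethod_remove_iff {n k : ℕ} :
    ((program n).remove 0 0).HasMethod 0 k ↔ ∃ i < n, i + 1 = k := by
  rw [Program.hasMethod_remove, show (0 : Name) = (cls n).name from rfl,
    (wellFormed n).hasMethod_iff (List.mem_singleton_self _)]
  constructor
  · rintro ⟨⟨d, hd, rfl⟩, hne⟩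
    rcases mem_methods.1 hd with rfl | ⟨i, hi, rfl⟩
    · exact absurd rfl hne
    · exact ⟨i, hi, rfl⟩
  · rintro ⟨i, hi, rfl⟩
    exact ⟨⟨observer i, mem_methods.2 (Or.inr ⟨i, hi, rfl⟩), rfl⟩, Nat.succ_ne_zero i⟩

theorem ncard_methods_remove (n : ℕ) :
    {k | ((program n).remove 0 0).HasMethod 0 k}.ncard = n := by
  have : {k | ((program n).remove 0 0).HasMethod 0 k} =
      ((Finset.range n).image (· + 1) : Finset ℕ) := by
    ext k
    simp [hasMethod_remove_iff]
  rw [this, Set.ncard_coe_finset, Finset.card_image_of_injective _ (add_left_injective 1),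
    Finset.card_range]

/-- Without controllers the region is an empty conjunction. -/
theorem ctrlGenerator_remove_valid (n : ℕ) {x : Point} (hx : x.cls = 0) :
    (((program n).remove 0 0).ctrlGenerator x).Valid := by
  intro σ
  simp only [Program.ctrlGenerator, hx, Fml.sat_conj, List.mem_map]
  rintro φ ⟨d, hd, -⟩
  rw [Program.mem_controllers (D := (cls n).remove 0 0)
    (by rw [Program.findClass_remove, findClass]; rfl)] at hd
  exact absurd hd.2 (not_isController_remove n _)

/-- The final `pr` is false in every state, so it is enough to exhibit one terminating run from a
state that satisfies the precondition; the all-zero state serves for every block. -/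
theorem not_valid_remove {n : ℕ} {b : Block} (hb : ((program n).remove 0 0).HasBlock 0 b) :
    ¬ (((program n).remove 0 0).ctrlObligation 0 b).Valid := by
  have hfind : ((program n).remove 0 0).findClass 0 = some ((cls n).remove 0 0) := by
    rw [Program.findClass_remove, findClass]; rfl
  intro hv
  cases b with
  | init =>
    rw [Program.ctrlObligation_init hfind] at hv
    refine absurd ((hv fun _ => 0).resolve_left (not_not_intro ⟨rfl, rfl⟩)
      (Function.update (fun _ => 0) (.prog (.field 0)) 0) ⟨_, rfl, rfl, rfl⟩).2
      (not_pr_of_forall rfl rfl (ctrlGenerator_remove_valid n rfl) _)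
  | method k =>
    obtain ⟨i, hi, rfl⟩ := hasMethod_remove_iff.1 hb
    have hfm : ((cls n).remove 0 0).findMethod (i + 1) = some (observer i) := by
      rw [ClassDecl.findMethod_remove (fun h => Nat.succ_ne_zero i h.2),
        show (cls n).findMethod (i + 1) = some (observer i) from
          (wellFormed n).findMethod (List.mem_singleton_self _)
            (mem_methods.2 (Or.inr ⟨i, hi, rfl⟩))]
      rfl
    rw [Program.ctrlObligation_method hfind hfm] at hv
    have h0 := (hv fun _ => 0).resolve_left
      (not_not_intro ⟨(zero_le_one : (0 : ℝ) ≤ 1), rfl, rfl⟩)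
    obtain ⟨σ', hr⟩ : ∃ σ', ((observer i).body.trans ((program n).remove 0 0)
        ((program n).remove 0 0).ctrlGenerator ((cls n).remove 0 0)).Run (fun _ => 0) σ' := by
      -- Level `1` is the one value meeting both guard and invariant, so setting the level to `1`
      -- completes the `await` whichever way the safety check goes.
      have hlevel : ∀ ρ : State, (Guard.fml guard).Sat (Function.update ρ (.prog (.field 0)) 1) ∧
          (cls n).inv.Sat (Function.update ρ (.prog (.field 0)) 1) := fun ρ => by
        simp [Guard.fml, guard, Expr.fml, Expr.trans, Term.map, Term.toFml, Fml.Sat, Term.eval, cls]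
      by_cases hpr : (((cls n).remove 0 0).pr (guard.region
          (((program n).remove 0 0).ctrlGenerator (.await 0 (i + 1))))).Sat fun _ => 0
      · exact ⟨_, Or.inl ⟨_, ⟨rfl, hpr⟩, _, ⟨_, ⟨1, rfl⟩, rfl, rfl⟩, rfl, hlevel _⟩⟩
      · exact ⟨_, Or.inr ⟨_, ⟨_, ⟨rfl, hpr⟩, rfl⟩, _, ⟨_, ⟨1, rfl⟩, rfl, rfl⟩, rfl,
          (hlevel _).1⟩⟩
    exact not_pr_of_forall rfl rfl (ctrlGenerator_remove_valid n rfl) _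
      (h0 _ ⟨σ', hr, rfl⟩).2.2

end Tank
end HABS

theorem mainTheorem11 :
    (∀ (P : HABS.Program) (C : HABS.Name), P.WellFormed → P.HasClass C → P.Verified C →
      (∀ m : HABS.Name, P.HasMethod C m →
        (P.IsController C m → HABS.NoNewController P (P.remove C m) C →
          ∀ b, (P.remove C m).HasBlock C b → HABS.NeedsReproof P (P.remove C m) C b) ∧
        (¬ P.IsController C m →
          ((P.remove C m).Verified C ↔
            ∀ b, (P.remove C m).HasBlock C b → P.BlockCalls C b m →
              ((P.remove C m).ctrlObligation C b).Valid) ∧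
          (HABS.NoNewController P (P.remove C m) C →
            ∀ b, (P.remove C m).HasBlock C b →
              (HABS.NeedsReproof P (P.remove C m) C b ↔ P.BlockCalls C b m)))) ∧
      (∀ d : HABS.MethodDecl, (P.add C d).WellFormed →
        (∀ k, P.IsController C k → ¬ d.body.Calls (some C) C k) →
          ((P.add C d).Verified C ↔ ((P.add C d).ctrlObligation C (.method d.name)).Valid) ∧
          ∀ b, P.HasBlock C b → ¬ HABS.NeedsReproof P (P.add C d) C b)) ∧
    (∀ n : ℕ, ∃ (P : HABS.Program) (C m : HABS.Name),
      P.WellFormed ∧ P.SuspensionLeading ∧ P.HasClass C ∧ P.Verified C ∧ P.IsController C m ∧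
      HABS.NoNewController P (P.remove C m) C ∧
      {k | (P.remove C m).HasMethod C k}.ncard = n ∧
      ∀ b, (P.remove C m).HasBlock C b → ¬ ((P.remove C m).ctrlObligation C b).Valid) := by
  refine ⟨fun P C hP hC hver => ⟨fun m hm => ⟨fun hctrl hnew b hb =>
    HABS.needsReproof_remove_of_isController hP hm hctrl hnew hb, fun hctrl =>
    ⟨HABS.verified_remove_iff hP hC hver hctrl, fun hnew b hb => ⟨fun h => ?_,
      HABS.needsReproof_remove_of_blockCalls hP hb⟩⟩⟩, fun d hd hcalls =>
    ⟨HABS.verified_add_iff hP hC hver hd hcalls, fun b hb =>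
      not_not_intro (HABS.ctrlObligation_add hP hd hcalls hb)⟩⟩, fun n => ?_⟩
  · by_contra hc
    exact HABS.not_needsReproof_remove hP hctrl hnew hb hc h
  · exact ⟨HABS.Tank.program n, 0, 0, HABS.Tank.wellFormed n, HABS.Tank.suspensionLeading n,
      ⟨HABS.Tank.cls n, List.mem_singleton_self _, rfl⟩, HABS.Tank.verified n,
      HABS.Tank.isController n, HABS.Tank.noNewController n, HABS.Tank.ncard_methods_remove n,
      fun b hb => HABS.Tank.not_valid_remove hb⟩
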